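/- Let $\mathbb{H}=\{z\in\mathbb{C}:\operatorname{Im} z>0\}$ and let $\eta(z)=e^{2\pi i z/24}\prod_{n\ge 1}(1-e^{2\pi i n z})$ be Dedekind's eta function on $\mathbb{H}$. For $N\ge 1$, an $\eta$-quotient of level $N$ is a function on $\mathbb{H}$ of the form $z\mapsto\prod_{\delta\mid N}\eta(\delta z)^{r_\delta}$ with all $r_\delta\in\mathbb{Z}$. Let $M_k(\Gamma_1(N))$ and $S_k(\Gamma_1(N))$ denote the spaces of modular forms and of cusp forms of weight $k$ for $\Gamma_1(N)$. **Theorem.** Let $p>3$ be a prime and let $k\ge 0$ be an integer. Then $M_k(\Gamma_1(p))\setminus S_k(\Gamma_1(p))$ contains an $\eta$-quotient of level $p$ if and only if $\frac{p-1}{2}$ divides $k$. Furthermore, if $k>0$ and $\frac{p-1}{2}$ divides $k$, then there are exactly two $\eta$-quotients of level $p$ in $M_k(\Gamma_1(p))\setminus S_k(\Gamma_1(p))$, namely the two distinct functions $$\frac{\eta(pz)^{2pk/(p-1)}}{\eta(z)^{2k/(p-1)}}\qquad\text{and}\qquad\frac{\eta(z)^{2pk/(p-1)}}{\eta(pz)^{2k/(p-1)}}.$$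 -/

import Mathlib

open UpperHalfPlane

open scoped MatrixGroups

noncomputable section

/-- The function `z ↦ ∏_{δ ∣ N} η(δ z) ^ (r δ)` on the upper half-plane, for a level `N ≥ 1`
and integer exponents `r δ`; only the values of `r` at the divisors of `N` matter. -/
def etaQuotient (N : ℕ) (r : ℕ → ℤ) : ℍ → ℂ :=
  fun z ↦ ∏ δ ∈ N.divisors, ModularForm.eta ((δ : ℂ) * (z : ℂ)) ^ r δ

/-- `f` is an eta-quotient of level `N`. -/
def IsEtaQuotient (N : ℕ) (f : ℍ → ℂ) : Prop :=
  ∃ r : ℕ → ℤ, f = etaQuotient N r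

/-- `M_k(Γ)`, for a subgroup `Γ` of `SL(2, ℤ)`, as a set of functions on the upper half-plane. -/
def modularFormSet (Γ : Subgroup SL(2, ℤ)) (k : ℤ) : Set (ℍ → ℂ) :=
  Set.range fun F : ModularForm (Γ : Subgroup (GL (Fin 2) ℝ)) k ↦ (F : ℍ → ℂ)

/-- `S_k(Γ)`, for a subgroup `Γ` of `SL(2, ℤ)`, as a set of functions on the upper half-plane. -/
def cuspFormSet (Γ : Subgroup SL(2, ℤ)) (k : ℤ) : Set (ℍ → ℂ) :=
  Set.range fun F : CuspForm (Γ : Subgroup (GL (Fin 2) ℝ)) k ↦ (F : ℍ → ℂ)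

/-- The eta-quotients of level `N` that lie in `M_k(Γ₁(N)) ∖ S_k(Γ₁(N))`. -/
def nonCuspidalEtaQuotients (N : ℕ) (k : ℤ) : Set (ℍ → ℂ) :=
  {f | IsEtaQuotient N f ∧
    f ∈ modularFormSet (CongruenceSubgroup.Gamma1 N) k \
      cuspFormSet (CongruenceSubgroup.Gamma1 N) k}

/-- The function `z ↦ η(p z) ^ (2pk/(p-1)) / η(z) ^ (2k/(p-1))`. The integer divisions are exact
when `p` is odd and `(p-1)/2` divides `k`. -/
def etaQuotientOne (p : ℕ) (k : ℤ) : ℍ → ℂ :=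
  fun z ↦ ModularForm.eta ((p : ℂ) * (z : ℂ)) ^ (2 * (p : ℤ) * k / ((p : ℤ) - 1)) /
    ModularForm.eta (z : ℂ) ^ (2 * k / ((p : ℤ) - 1))

/-- The function `z ↦ η(z) ^ (2pk/(p-1)) / η(p z) ^ (2k/(p-1))`. The integer divisions are exact
when `p` is odd and `(p-1)/2` divides `k`. -/
def etaQuotientTwo (p : ℕ) (k : ℤ) : ℍ → ℂ :=
  fun z ↦ ModularForm.eta (z : ℂ) ^ (2 * (p : ℤ) * k / ((p : ℤ) - 1)) /
    ModularForm.eta ((p : ℂ) * (z : ℂ)) ^ (2 * k / ((p : ℤ) - 1))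

end

/-!
Write `p = 2 m + 1`. An eta quotient of level `p` is `η(z) ^ a * η(p z) ^ b` (`etaPair`). Absolute
values do not see the multiplier system of `η`, and `|η(γ z)| ^ 2 = |c z + d| * |η(z)| ^ 2`
determines both the weight `(a + b) / 2` and the orders at the cusps: up to a common factor they are
`a + p b` at the cusps over `∞` and `a + b / p` at those over `0` (`hasExpOrder_etaPair_slash`). So
a modular form of this shape has non-negative orders, and it fails to be a cusp form exactly when
one of the two orders is zero. With `a + b = 2 k` this leaves the powers of `g = η(z) ^ p / η(p z)` and
of `h = η(p z) ^ p / η(z)`, which have weight `m`, and forces `m ∣ k`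
(`mem_nonCuspidalEtaQuotients_iff`).

It remains to see that `g` and `h` are invariant under `Γ₁(p)`. The Fricke involution
`z ↦ -1 / (p z)` exchanges them, so `g` suffices (`etaPair_smul'`). No formula for the full
multiplier system of `η` is needed, because the invariance of `g ^ 8` and of `g ^ 3` is enough.

* `η ^ 8` transforms under `SL(2, ℤ)` by a character of order three with an explicit formula modulo
  `3` (`etaEighthTransform`). In `g ^ 8` the characters of the two factors cancel on `Γ₀(p)`, since
  `p ^ 2 ≡ 1` modulo `3` (`etaPair_smul_pow_eight`).
* Let `P` be the product over `0 < j ≤ m` of the weight-three Eisenstein series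
  `∑ (c z + d) ^ (-3)` over all `(c, d) ≡ (0, j)` modulo `p`. These series are permuted by
  `SL(2, ℤ)` along with the vectors `(0, j)`, so `P` is plainly invariant under `Γ₁(p)`. At the
  cusps over `0` the Lipschitz formula gives `P` the order `1 + 2 + ⋯ + m = (p ^ 2 - 1) / 8`, which is the
  order of `g ^ 3`, whereas `g` has order zero over `∞`. As `η` has no zeros, `P ^ 8 / g ^ 24` is a
  modular form of weight zero, hence constant (`exists_eisensteinProduct_pow_eq`), so `P` is a
  constant multiple of `g ^ 3` (`exists_eisensteinProduct_eq`). The constant is not zero because `P`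
  does not vanish at `i∞`.
-/

section EtaQuotients

open ModularForm Filter Topology EisensteinSeries CongruenceSubgroup
open Complex hiding eta

/-! ### The action of `SL(2, ℤ)` in coordinates -/

lemma SL_det_eq_one (γ : SL(2, ℤ)) : γ 0 0 * γ 1 1 - γ 0 1 * γ 1 0 = 1 := by
  have := γ.det_coe
  rwa [Matrix.det_fin_two] at this

lemma SL_det_cast_eq_one (N : ℕ) (γ : SL(2, ℤ)) :
    (γ 0 0 : ZMod N) * γ 1 1 - γ 0 1 * γ 1 0 = 1 := by
  exact_mod_cast congrArg (Int.cast : ℤ → ZMod N) (SL_det_eq_one γ)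

lemma coe_SL_smul (γ : SL(2, ℤ)) (z : ℍ) :
    ((γ • z : ℍ) : ℂ) = ((γ 0 0 : ℂ) * z + γ 0 1) / ((γ 1 0 : ℂ) * z + γ 1 1) := by
  rw [UpperHalfPlane.specialLinearGroup_apply]
  simp

lemma denom_SL (γ : SL(2, ℤ)) (z : ℂ) :
    denom γ z = (γ 1 0 : ℂ) * z + γ 1 1 := by
  simp [denom]

lemma denom_SL_mul (x y : SL(2, ℤ)) (z : ℍ) :
    denom (x * y : SL(2, ℤ)) z = denom x ((y • z : ℍ) : ℂ) * denom y z := by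
  have hd := UpperHalfPlane.denom_ne_zero y z
  rw [denom_SL] at hd
  rw [denom_SL, denom_SL, denom_SL, coe_SL_smul]
  simp only [Matrix.SpecialLinearGroup.coe_mul, Matrix.mul_apply, Fin.sum_univ_two]
  push_cast
  field_simp
  ring

/-! ### The eighth power of the eta function -/

/-- The polynomial in the entries of a matrix which, on `SL(2, ℤ/3)`, is the homomorphism to `ℤ/3`
sending `T` to `1`. -/
def etaEighthExponent (γ : SL(2, ℤ)) : ZMod 3 :=
  ((γ 0 0 : ZMod 3) + γ 1 1) * γ 1 0 + (γ 0 1 : ZMod 3) * γ 1 1 * (1 - (γ 1 0 : ZMod 3) ^ 2)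

lemma etaEighthExponent_mul_T (γ : SL(2, ℤ)) :
    etaEighthExponent (γ * ModularGroup.T) = etaEighthExponent γ + 1 := by
  have key : ∀ a b c d : ZMod 3, a * d - b * c = 1 →
      (a + (c + d)) * c + (a + b) * (c + d) * (1 - c ^ 2) =
        (a + d) * c + b * d * (1 - c ^ 2) + 1 := by decide
  simpa [etaEighthExponent, Matrix.SpecialLinearGroup.coe_mul, ModularGroup.coe_T,
    Matrix.mul_apply, Fin.sum_univ_two] using key _ _ _ _ (SL_det_cast_eq_one 3 γ)

lemma etaEighthExponent_mul_S (γ : SL(2, ℤ)) :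
    etaEighthExponent (γ * ModularGroup.S) = etaEighthExponent γ := by
  have key : ∀ a b c d : ZMod 3, a * d - b * c = 1 →
      (b + -c) * d + (-a) * (-c) * (1 - d ^ 2) = (a + d) * c + b * d * (1 - c ^ 2) := by decide
  simpa [etaEighthExponent, Matrix.SpecialLinearGroup.coe_mul, ModularGroup.coe_S,
    Matrix.mul_apply, Fin.sum_univ_two] using key _ _ _ _ (SL_det_cast_eq_one 3 γ)

/-- `η ^ 8` transforms under `γ` by its automorphy factor and the cubic character given by
`etaEighthExponent`. -/
def EtaEighthTransform (γ : SL(2, ℤ)) : Prop :=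
  ∀ z : ℍ, eta ((γ • z : ℍ) : ℂ) ^ 8 =
    ZMod.stdAddChar (etaEighthExponent γ) * denom γ z ^ 4 * eta z ^ 8

lemma etaEighthTransform_T : EtaEighthTransform ModularGroup.T := by
  intro z
  have h1 : etaEighthExponent ModularGroup.T = ((1 : ℤ) : ZMod 3) := by
    simp [etaEighthExponent, ModularGroup.T]
  rw [h1, ZMod.stdAddChar_coe, UpperHalfPlane.modular_T_smul]
  have h2 : ∀ n, eta_q n (((1 : ℝ) +ᵥ z : ℍ) : ℂ) = eta_q n z := by
    intro n
    simp [eta_q, Function.Periodic.qParam, UpperHalfPlane.coe_vadd, mul_add, Complex.exp_add]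
  have h3 : Function.Periodic.qParam 24 (((1 : ℝ) +ᵥ z : ℍ) : ℂ) ^ 8 =
      cexp (2 * Real.pi * Complex.I * (1 : ℤ) / (3 : ℕ)) * Function.Periodic.qParam 24 z ^ 8 := by
    simp only [Function.Periodic.qParam, ← Complex.exp_nat_mul, ← Complex.exp_add]
    congr 1
    push_cast [UpperHalfPlane.coe_vadd]
    ring
  have h4 : denom (ModularGroup.T : SL(2, ℤ)) z = 1 := by
    simp [denom_SL, ModularGroup.coe_T]
  rw [h4]
  simp only [eta, h2, mul_pow, h3]
  ring

lemma etaEighthTransform_S : EtaEighthTransform ModularGroup.S := by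
  intro z
  have h1 : etaEighthExponent ModularGroup.S = 0 := by
    simp [etaEighthExponent, ModularGroup.S]
  have h2 := eta_comp_eq_csqrt_I_inv z.2
  have hs : ∀ w : ℂ, w ≠ 0 → Complex.sqrt w ^ 8 = w ^ 4 := by
    intro w hw
    rw [Complex.sqrt, ← Complex.cpow_nat_mul]
    norm_num
  rw [h1, UpperHalfPlane.modular_S_smul]
  have h3 : ((-(z : ℂ))⁻¹) = -1 / (z : ℂ) := by rw [inv_neg, neg_div, one_div]
  simp only [Function.comp, Pi.smul_apply, Pi.mul_apply, smul_eq_mul] at h2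
  simp only [h3, h2, mul_pow, inv_pow, hs _ Complex.I_ne_zero, hs _ (UpperHalfPlane.ne_zero z),
    ModularGroup.denom_S, I_pow_four, AddChar.map_zero_eq_one]
  ring

lemma EtaEighthTransform.mul {x y : SL(2, ℤ)} (hx : EtaEighthTransform x)
    (hy : EtaEighthTransform y)
    (h : etaEighthExponent (x * y) = etaEighthExponent x + etaEighthExponent y) :
    EtaEighthTransform (x * y) := by
  intro z
  rw [mul_smul, hx, hy, h, AddChar.map_add_eq_mul, denom_SL_mul]
  ring

lemma EtaEighthTransform.mul_inv {x y : SL(2, ℤ)} (hx : EtaEighthTransform x)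
    (hy : EtaEighthTransform y)
    (h : etaEighthExponent x = etaEighthExponent (x * y⁻¹) + etaEighthExponent y) :
    EtaEighthTransform (x * y⁻¹) := by
  intro z
  obtain ⟨w, rfl⟩ : ∃ w, z = y • w := ⟨y⁻¹ • z, by simp⟩
  have hc : denom x w = denom (x * y⁻¹ : SL(2, ℤ)) ((y • w : ℍ) : ℂ) * denom y w := by
    rw [← denom_SL_mul, inv_mul_cancel_right]
  rw [mul_smul, inv_smul_smul, hx, hy, hc, h, AddChar.map_add_eq_mul]
  ring

/-- The eighth power of `η` transforms under the full modular group by a cubic character. -/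
theorem etaEighthTransform (γ : SL(2, ℤ)) : EtaEighthTransform γ := by
  have hγ : γ ∈ Subgroup.closure {ModularGroup.S, ModularGroup.T} := by
    rw [SpecialLinearGroup.SL2Z_generators]; trivial
  have hS0 : etaEighthExponent ModularGroup.S = 0 := by
    simp [etaEighthExponent, ModularGroup.S]
  have hT1 : etaEighthExponent ModularGroup.T = 1 := by
    simp [etaEighthExponent, ModularGroup.T]
  induction hγ using Subgroup.closure_induction_right with
  | one =>
    intro z
    simp [etaEighthExponent]
  | mul_right x _ y hy ih =>
    rcases hy with rfl | rfl
    · exact ih.mul etaEighthTransform_S (by rw [etaEighthExponent_mul_S, hS0, add_zero])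
    · exact ih.mul etaEighthTransform_T (by rw [etaEighthExponent_mul_T, hT1])
  | mul_inv_cancel x _ y hy ih =>
    rcases hy with rfl | rfl
    · refine ih.mul_inv etaEighthTransform_S ?_
      rw [← etaEighthExponent_mul_S (x * _), hS0]; simp
    · refine ih.mul_inv etaEighthTransform_T ?_
      rw [hT1, ← etaEighthExponent_mul_T (x * _)]; simp

lemma norm_eta_smul_sq (γ : SL(2, ℤ)) (z : ℍ) :
    ‖eta ((γ • z : ℍ) : ℂ)‖ ^ 2 = ‖denom γ z‖ * ‖eta z‖ ^ 2 := by
  have h := congrArg norm (etaEighthTransform γ z)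
  have h1 : ‖ZMod.stdAddChar (etaEighthExponent γ)‖ = 1 := by
    exact AddChar.norm_apply _ _
  simp only [norm_mul, norm_pow, h1, one_mul] at h
  refine (pow_left_inj₀ (by positivity) (by positivity) (four_ne_zero)).mp ?_
  rw [mul_pow, ← pow_mul, ← pow_mul]
  exact h

/-! ### Scaling the argument by a prime -/

/-- The point `p z` of the upper half-plane. -/
noncomputable def scale (p : ℕ) [NeZero p] (z : ℍ) : ℍ :=
  ⟨p * z, by
    have : (0 : ℝ) < p := Nat.cast_pos.mpr (NeZero.pos p)
    simpa using mul_pos this z.2⟩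

@[simp] lemma coe_scale (p : ℕ) [NeZero p] (z : ℍ) : (scale p z : ℂ) = p * z := rfl

@[simp] lemma im_scale (p : ℕ) [NeZero p] (z : ℍ) : (scale p z).im = p * z.im := by
  change ((p : ℂ) * (z : ℂ)).im = _
  simp

/-- The point `(z + j) / p` of the upper half-plane. -/
noncomputable def shiftDiv (p : ℕ) [NeZero p] (j : ℤ) (z : ℍ) : ℍ :=
  ⟨(z + j) / p, by
    have : (0 : ℝ) < p := Nat.cast_pos.mpr (NeZero.pos p)
    simpa [Complex.div_natCast_im] using div_pos z.2 this⟩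

@[simp] lemma coe_shiftDiv (p : ℕ) [NeZero p] (j : ℤ) (z : ℍ) :
    (shiftDiv p j z : ℂ) = (z + j) / p := rfl

@[simp] lemma im_shiftDiv (p : ℕ) [NeZero p] (j : ℤ) (z : ℍ) :
    (shiftDiv p j z).im = z.im / p := by
  change (((z : ℂ) + j) / p).im = _
  simp [Complex.div_natCast_im]

/-- For `γ ∈ Γ₀(p)`, scaling by `p` intertwines `γ = (a, b; c, d)` with `(a, p b; c / p, d)`. -/
lemma exists_scale_smul_of_dvd (p : ℕ) [NeZero p] (γ : SL(2, ℤ)) (h : (p : ℤ) ∣ γ 1 0) :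
    ∃ γ' : SL(2, ℤ), γ' 0 0 = γ 0 0 ∧ γ' 0 1 = p * γ 0 1 ∧ γ 1 0 = p * γ' 1 0 ∧
      γ' 1 1 = γ 1 1 ∧ ∀ z, scale p (γ • z) = γ' • scale p z ∧
        denom γ' (scale p z) = denom γ z := by
  obtain ⟨c, hc⟩ := h
  have hdet := SL_det_eq_one γ
  obtain ⟨γ', hγ'⟩ : ∃ γ' : SL(2, ℤ), γ'.1 = !![γ 0 0, p * γ 0 1; c, γ 1 1] :=
    ⟨⟨_, by rw [Matrix.det_fin_two_of]; linear_combination hdet + γ 0 1 * hc⟩, rfl⟩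
  have e00 : γ' 0 0 = γ 0 0 := by simp [hγ']
  have e01 : γ' 0 1 = p * γ 0 1 := by simp [hγ']
  have e10 : γ' 1 0 = c := by simp [hγ']
  have e11 : γ' 1 1 = γ 1 1 := by simp [hγ']
  refine ⟨γ', e00, e01, by rw [hc, e10], e11, fun z ↦ ?_⟩
  · have hd := UpperHalfPlane.denom_ne_zero γ z
    constructor
    · ext1
      rw [denom_SL] at hd
      rw [coe_scale, coe_SL_smul, coe_SL_smul]
      simp only [coe_scale, e00, e01, e10, e11, hc] at hd ⊢
      push_cast at hd ⊢
      have : (c : ℂ) * (p * z) + (γ 1 1 : ℂ) = p * c * z + γ 1 1 := by ring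
      rw [this]
      field_simp
    · rw [denom_SL, denom_SL]
      simp only [coe_scale, e10, e11, hc]
      push_cast
      ring

/-- For `γ = (a, b; c, d)` with `c` prime to `p`, the point `p γ z` is an `SL(2, ℤ)`-translate of
`(z + j) / p`, where `c j ≡ d` modulo `p`. -/
lemma exists_scale_smul_of_not_dvd (p : ℕ) [hp : Fact p.Prime] (γ : SL(2, ℤ))
    (h : ¬ (p : ℤ) ∣ γ 1 0) :
    ∃ (γ' : SL(2, ℤ)) (j : ℤ), ∀ z, scale p (γ • z) = γ' • shiftDiv p j z ∧
        p * denom γ' (shiftDiv p j z) = denom γ z := by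
  have hdet := SL_det_eq_one γ
  have hcop : IsCoprime (γ 1 0) (p : ℤ) := by
    have := (Nat.prime_iff_prime_int.mp hp.out).coprime_iff_not_dvd.mpr h
    exact this.symm
  obtain ⟨u, v, huv⟩ := hcop
  have hp0 : (p : ℂ) ≠ 0 := Nat.cast_ne_zero.mpr hp.out.ne_zero
  -- with `u c + v p = 1`, take `j = u d`, so that `d - c j = v p d`
  obtain ⟨γ', hγ'⟩ : ∃ γ' : SL(2, ℤ),
      γ'.1 = !![p * γ 0 0, γ 0 1 - γ 0 0 * (u * γ 1 1); γ 1 0, v * γ 1 1] :=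
    ⟨⟨_, by
      rw [Matrix.det_fin_two_of]; linear_combination (γ 0 0 * γ 1 1) * huv + hdet⟩, rfl⟩
  have e00 : γ' 0 0 = p * γ 0 0 := by simp [hγ']
  have e01 : γ' 0 1 = γ 0 1 - γ 0 0 * (u * γ 1 1) := by simp [hγ']
  have e10 : γ' 1 0 = γ 1 0 := by simp [hγ']
  have e11 : γ' 1 1 = v * γ 1 1 := by simp [hγ']
  refine ⟨γ', u * γ 1 1, fun z ↦ ?_⟩
  have hd := UpperHalfPlane.denom_ne_zero γ z
  have huv' : (u : ℂ) * γ 1 0 + v * p = 1 := by exact_mod_cast congrArg (Int.cast : ℤ → ℂ) huv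
  have key : (γ 1 0 : ℂ) * ((z + (u * γ 1 1 : ℤ)) / p) + (v * γ 1 1 : ℤ) =
      (γ 1 0 * z + γ 1 1) / p := by
    push_cast
    field_simp
    linear_combination (γ 1 1 : ℂ) * huv'
  constructor
  · ext1
    rw [denom_SL] at hd
    rw [coe_scale, coe_SL_smul, coe_SL_smul]
    simp only [coe_shiftDiv, e00, e01, e10, e11]
    rw [key]
    push_cast
    field_simp
    ring
  · rw [denom_SL, denom_SL]
    simp only [coe_shiftDiv, e10, e11]
    rw [key]
    field_simp

/-! ### Eisenstein series of weight three with a congruence condition -/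

/-- The integer vectors congruent to `a` modulo `N`. -/
def congruentVectors (N : ℕ) (a : Fin 2 → ZMod N) : Set (Fin 2 → ℤ) :=
  {v | (v 0 : ZMod N) = a 0 ∧ (v 1 : ZMod N) = a 1}

/-- The Eisenstein series of weight `3` over all integer vectors congruent to `a` modulo `N`, not
only the primitive ones; up to a factor it is the value of `℘'` at an `N`-division point. -/
noncomputable def cubicEisenstein (N : ℕ) (a : Fin 2 → ZMod N) (z : ℍ) : ℂ :=
  ∑' v : congruentVectors N a, eisSummand 3 v z

lemma cubicEisenstein_smul (N : ℕ) (a b : Fin 2 → ZMod N) (γ : SL(2, ℤ))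
    (h0 : b 0 = a 0 * γ 0 0 + a 1 * γ 1 0) (h1 : b 1 = a 0 * γ 0 1 + a 1 * γ 1 1) (z : ℍ) :
    cubicEisenstein N a (γ • z) = denom γ z ^ 3 * cubicEisenstein N b z := by
  have hdet := SL_det_cast_eq_one N γ
  let e : (Fin 2 → ℤ) ≃ (Fin 2 → ℤ) :=
    { toFun := fun v ↦ Matrix.vecMul v γ.1
      invFun := fun v ↦ Matrix.vecMul v (γ⁻¹).1
      left_inv := fun v ↦ by
        simp only [Matrix.vecMul_vecMul]
        rw [← Matrix.SpecialLinearGroup.coe_mul, mul_inv_cancel, Matrix.SpecialLinearGroup.coe_one,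
          Matrix.vecMul_one]
      right_inv := fun v ↦ by
        simp only [Matrix.vecMul_vecMul]
        rw [← Matrix.SpecialLinearGroup.coe_mul, inv_mul_cancel, Matrix.SpecialLinearGroup.coe_one,
          Matrix.vecMul_one] }
  have he : ∀ v, v ∈ congruentVectors N a ↔ e v ∈ congruentVectors N b := by
    intro v
    simp only [congruentVectors, Set.mem_ofPred_eq, e, Equiv.coe_fn_mk, Matrix.vecMul,
      Matrix.vec2_dotProduct, h0, h1]
    push_cast
    constructor
    · rintro ⟨h, h'⟩
      rw [h, h']
      exact ⟨rfl, rfl⟩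
    · rintro ⟨h, h'⟩
      constructor
      · linear_combination (γ 1 1 : ZMod N) * h - (γ 1 0 : ZMod N) * h' +
          (a 0 - (v 0 : ZMod N)) * hdet
      · linear_combination (γ 0 0 : ZMod N) * h' - (γ 0 1 : ZMod N) * h +
          (a 1 - (v 1 : ZMod N)) * hdet
  rw [cubicEisenstein, cubicEisenstein, ← (Equiv.subtypeEquiv e he).tsum_eq, ← tsum_mul_left]
  refine tsum_congr fun v ↦ ?_
  rw [eisSummand_SL2_apply]
  norm_cast

lemma differentiableOn_cubicEisenstein (N : ℕ) (a : Fin 2 → ZMod N) :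
    DifferentiableOn ℂ (cubicEisenstein N a ∘ ofComplex) {z : ℂ | 0 < z.im} := by
  have h1 : TendstoLocallyUniformly
      (fun (s : Finset (congruentVectors N a)) ↦ (fun z ↦ ∑ x ∈ s, eisSummand 3 x z))
      (cubicEisenstein N a) Filter.atTop := by
    have hk' : (2 : ℝ) < 3 := by norm_num
    have p_sum : Summable fun x : congruentVectors N a ↦ ‖x.val‖ ^ (-3 : ℝ) :=
      (summable_one_div_norm_rpow hk').subtype (· ∈ congruentVectors N a)
    simp only [tendstoLocallyUniformly_iff_forall_isCompact]
    intro K hK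
    obtain ⟨A, B, hB, HABK⟩ := subset_verticalStrip_of_isCompact hK
    refine (tendstoUniformlyOn_tsum (hu := p_sum.mul_left <| r ⟨⟨A, B⟩, hB⟩ ^ (-3 : ℝ))
      (fun v z hz ↦ ?_)).mono HABK
    have := summand_bound_of_mem_verticalStrip (k := 3) (by positivity) v hB hz
    rw [eisSummand, norm_zpow]
    exact_mod_cast this
  have h2 : TendstoLocallyUniformlyOn
      (fun (s : Finset (congruentVectors N a)) ↦
        ((fun z : ℍ ↦ ∑ x ∈ s, eisSummand 3 x z) ∘ ofComplex))
      (cubicEisenstein N a ∘ ofComplex) Filter.atTop {z : ℂ | 0 < z.im} := by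
    rw [← upperHalfPlaneSet, ← range_coe, ← Set.image_univ]
    apply TendstoLocallyUniformlyOn.comp (s := ⊤) _ _ _ (OpenPartialHomeomorph.continuousOn_symm _)
    · simpa only [Set.top_eq_univ, tendstoLocallyUniformlyOn_univ] using h1
    · simp only [IsOpenEmbedding.toOpenPartialHomeomorph_target, Set.top_eq_univ,
        Set.mapsTo_range_iff, Set.mem_univ, forall_const]
  exact h2.differentiableOn
    (Eventually.of_forall fun s ↦ DifferentiableOn.fun_sum
      fun _ _ ↦ eisSummand_extension_differentiableOn _ _) isOpen_upperHalfPlaneSet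

/-! ### Behaviour of the cubic Eisenstein series at infinity -/

/-- The part of the Eisenstein series over the vectors `(c, d)` with `c` fixed and `d ≡ b`
modulo `N`. -/
noncomputable def eisensteinRow (N : ℕ) (c b : ℤ) (z : ℍ) : ℂ :=
  ∑' n : ℤ, 1 / ((c : ℂ) * z + (b + N * n)) ^ 3

/-- Integer vectors congruent to `(a, b)` modulo `N` are parametrised by `ℤ × ℤ`. -/
lemma cubicEisenstein_eq_tsum_row (N : ℕ) [NeZero N] (a b : ℤ) (z : ℍ) :
    (Summable fun m : ℤ ↦ eisensteinRow N (a + N * m) b z) ∧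
    cubicEisenstein N ![a, b] z = ∑' m : ℤ, eisensteinRow N (a + N * m) b z := by
  have hN : (N : ℤ) ≠ 0 := Nat.cast_ne_zero.mpr (NeZero.ne N)
  let φ : ℤ × ℤ → congruentVectors N ![a, b] := fun x ↦
    ⟨![a + N * x.1, b + N * x.2], by simp [congruentVectors]⟩
  have hφ : Function.Bijective φ := by
    constructor
    · intro x y hxy
      have h := congrArg Subtype.val hxy
      have h0 := congrFun h 0
      have h1 := congrFun h 1
      simp only [φ, Matrix.cons_val_zero, Matrix.cons_val_one, add_right_inj, mul_eq_mul_left_iff,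
        hN, or_false] at h0 h1
      exact Prod.ext h0 h1
    · rintro ⟨v, hv⟩
      simp only [congruentVectors, Set.mem_ofPred_eq, Matrix.cons_val_zero, Matrix.cons_val_one,
        ZMod.intCast_eq_intCast_iff_dvd_sub] at hv
      obtain ⟨⟨m, hm⟩, ⟨n, hn⟩⟩ := hv
      refine ⟨(-m, -n), ?_⟩
      ext i
      fin_cases i
      · simp [φ]; linarith
      · simp [φ]; linarith
  let e := Equiv.ofBijective φ hφ
  have hs0 : Summable fun v : congruentVectors N ![(a : ZMod N), b] ↦ eisSummand 3 v z :=
    (summable_eisSummand (k := 3) le_rfl z).subtype _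
  have hs : Summable fun x : ℤ × ℤ ↦
      1 / ((((a + N * x.1 : ℤ)) : ℂ) * z + (b + N * x.2)) ^ 3 := by
    refine (e.summable_iff.mpr hs0).congr fun x ↦ ?_
    simp only [Function.comp, e, Equiv.ofBijective_apply, φ, eisSummand]
    simp
  refine ⟨hs.prod, ?_⟩
  rw [cubicEisenstein, ← e.tsum_eq]
  simp only [eisensteinRow]
  rw [← hs.tsum_prod]
  refine tsum_congr fun x ↦ ?_
  simp only [e, Equiv.ofBijective_apply, φ, eisSummand]
  simp

/-- By the Lipschitz formula the sum is a power series in `exp (2 π i w)` without constant term. -/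
lemma exists_norm_tsum_inv_cube_le (δ : ℝ) (hδ : 0 < δ) :
    ∃ C : ℝ, 0 ≤ C ∧ ∀ w : ℍ, δ ≤ w.im →
      ‖∑' n : ℤ, 1 / ((w : ℂ) + n) ^ 3‖ ≤ C * Real.exp (-2 * Real.pi * w.im) := by
  set ρ := Real.exp (-2 * Real.pi * δ) with hρ
  have hρ0 : 0 < ρ := Real.exp_pos _
  have hρ1 : ρ < 1 := by
    rw [hρ, Real.exp_lt_one_iff]
    nlinarith [Real.pi_pos]
  have hsum : Summable fun n : ℕ ↦ (n : ℝ) ^ 2 * ρ ^ n := by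
    have := summable_pow_mul_geometric_of_norm_lt_one (R := ℝ) 2 (r := ρ)
      (by rwa [Real.norm_of_nonneg hρ0.le])
    simpa using this
  set A := ‖((-2 * (Real.pi : ℂ) * Complex.I) ^ (2 + 1) / (Nat.factorial 2 : ℂ))‖
  refine ⟨A * (ρ⁻¹ * ∑' n : ℕ, (n : ℝ) ^ 2 * ρ ^ n), by positivity, fun w hw ↦ ?_⟩
  rw [show (3 : ℕ) = 2 + 1 from rfl, qExpansion_identity (by norm_num) w, norm_mul, mul_assoc A]
  refine mul_le_mul_of_nonneg_left ?_
    (norm_nonneg ((-2 * (Real.pi : ℂ) * Complex.I) ^ (2 + 1) / (Nat.factorial 2 : ℂ)))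
  have hq : ‖cexp (2 * Real.pi * Complex.I * w)‖ = Real.exp (-2 * Real.pi * w.im) := by
    simp [Complex.norm_exp]
  have hle : Real.exp (-2 * Real.pi * w.im) ≤ ρ := by
    rw [hρ, Real.exp_le_exp]
    nlinarith [Real.pi_pos]
  set q := Real.exp (-2 * Real.pi * w.im)
  have hq0 : 0 ≤ q := (Real.exp_pos _).le
  have : HasSum (fun n : ℕ ↦ ρ⁻¹ * q * ((n : ℝ) ^ 2 * ρ ^ n))
      (ρ⁻¹ * q * ∑' n : ℕ, (n : ℝ) ^ 2 * ρ ^ n) := hsum.hasSum.mul_left _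
  refine (tsum_of_norm_bounded this fun n ↦ ?_).trans (le_of_eq (by ring))
  rw [norm_mul, norm_pow, norm_pow, hq, Complex.norm_natCast]
  rcases n with _ | n
  · simp
  · have : q ^ n ≤ ρ ^ n := pow_le_pow_left₀ hq0 hle n
    have e : ρ⁻¹ * q * (((n + 1 : ℕ) : ℝ) ^ 2 * ρ ^ (n + 1)) =
        ((n + 1 : ℕ) : ℝ) ^ 2 * (q * ρ ^ n) := by
      field_simp
      ring
    rw [e, pow_succ' q]
    gcongr

/-- The rows with `c ≠ 0` are exponentially small, by the Lipschitz formula. -/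
lemma exists_norm_eisensteinRow_le (N : ℕ) [NeZero N] :
    ∃ C : ℝ, 0 ≤ C ∧ ∀ (c b : ℤ) (z : ℍ), c ≠ 0 → 1 ≤ z.im →
      ‖eisensteinRow N c b z‖ ≤ C * Real.exp (-2 * Real.pi * |(c : ℝ)| * z.im / N) := by
  have hN : (0 : ℝ) < N := Nat.cast_pos.mpr (NeZero.pos N)
  have hN' : (N : ℂ) ≠ 0 := Nat.cast_ne_zero.mpr (NeZero.ne N)
  obtain ⟨C, hC, h⟩ := exists_norm_tsum_inv_cube_le (1 / N) (by positivity)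
  refine ⟨‖((N : ℂ) ^ 3)⁻¹‖ * C, by positivity, ?_⟩
  have hpos : ∀ (c b : ℤ) (z : ℍ), 0 < c → 1 ≤ z.im →
      ‖eisensteinRow N c b z‖ ≤ ‖((N : ℂ) ^ 3)⁻¹‖ * C *
        Real.exp (-2 * Real.pi * (c : ℝ) * z.im / N) := by
    intro c b z hc hz
    have hc1 : (1 : ℝ) ≤ c := by exact_mod_cast hc
    have him : (((c : ℂ) * z + b) / N).im = c * z.im / N := by
      rw [Complex.div_natCast_im]; simp
    have hle : 1 / (N : ℝ) ≤ c * z.im / N := by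
      gcongr
      nlinarith
    let w : ℍ := ⟨((c : ℂ) * z + b) / N, by
      rw [him]; exact lt_of_lt_of_le (by positivity) hle⟩
    have hw : w.im = c * z.im / N := him
    have hrow : eisensteinRow N c b z = ((N : ℂ) ^ 3)⁻¹ * ∑' n : ℤ, 1 / ((w : ℂ) + n) ^ 3 := by
      rw [eisensteinRow, ← tsum_mul_left]
      refine tsum_congr fun n ↦ ?_
      have : (c : ℂ) * z + (b + N * n) = N * ((w : ℂ) + n) := by
        change _ = (N : ℂ) * (((c : ℂ) * z + b) / N + n)
        field_simp
        ring
      rw [this, mul_pow, one_div, mul_inv, one_div]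
    rw [hrow, norm_mul, mul_assoc]
    refine mul_le_mul_of_nonneg_left ?_ (norm_nonneg _)
    refine (h w (by rwa [hw])).trans (le_of_eq ?_)
    rw [hw]
    congr 2
    ring
  intro c b z hc hz
  rcases lt_or_gt_of_ne hc with hc | hc
  · have e : eisensteinRow N c b z = - eisensteinRow N (-c) (-b) z := by
      rw [eisensteinRow, eisensteinRow, ← tsum_neg, ← (Equiv.neg ℤ).tsum_eq]
      refine tsum_congr fun n ↦ ?_
      have : ((-c : ℤ) : ℂ) * z + ((-b : ℤ) + N * n) =
          - ((c : ℂ) * z + (b + N * ((Equiv.neg ℤ n : ℤ) : ℂ))) := by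
        simp; ring
      rw [this, Odd.neg_pow (by decide), one_div, one_div, inv_neg, neg_neg]
    have := hpos (-c) (-b) z (by linarith) hz
    rw [e, norm_neg, abs_of_neg (by exact_mod_cast hc)]
    exact_mod_cast this
  · rw [abs_of_pos (by exact_mod_cast hc)]
    exact hpos c b z hc hz

lemma summable_exp_neg_abs (N : ℕ) [NeZero N] (a : ℤ) (t : ℝ) (ht : t < 0) :
    Summable fun m : ℤ ↦ Real.exp (t * |((a + N * m : ℤ) : ℝ)|) := by
  have hN : (N : ℤ) ≠ 0 := Nat.cast_ne_zero.mpr (NeZero.ne N)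
  have h1 : Summable fun m : ℤ ↦ Real.exp (t * |(m : ℝ)|) := by
    have h0 : Summable fun n : ℕ ↦ Real.exp (t * n) := by
      simp_rw [mul_comm t]
      exact Real.summable_exp_nat_mul_iff.mpr ht
    rw [summable_int_iff_summable_nat_and_neg]
    exact ⟨by simpa using h0, by simpa using h0⟩
  exact h1.comp_injective (i := fun m : ℤ ↦ a + N * m) fun x y hxy ↦
    mul_left_cancel₀ hN (add_left_cancel hxy)

/-- The rows with `c ≠ 0` decay together like the slowest of them. -/
lemma exists_norm_tsum_row_le (N : ℕ) [NeZero N] (a b : ℤ) (μ : ℕ)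
    (hμ : ∀ m : ℤ, a + N * m = 0 ∨ (μ : ℤ) ≤ |a + N * m|) :
    ∃ K : ℝ, 0 ≤ K ∧ ∀ z : ℍ, 1 ≤ z.im →
      ‖∑' m : ℤ, if a + N * m = 0 then 0 else eisensteinRow N (a + N * m) b z‖ ≤
        K * Real.exp (-2 * Real.pi * μ * z.im / N) := by
  have hN : (0 : ℝ) < N := Nat.cast_pos.mpr (NeZero.pos N)
  obtain ⟨C, hC, h⟩ := exists_norm_eisensteinRow_le N
  have hs := (summable_exp_neg_abs N a (-2 * Real.pi / N)
    (div_neg_of_neg_of_pos (by linarith [Real.pi_pos]) hN)).mul_left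
    (C * Real.exp (2 * Real.pi * μ / N))
  set S := ∑' m : ℤ, C * Real.exp (2 * Real.pi * μ / N) *
    Real.exp (-2 * Real.pi / N * |((a + N * m : ℤ) : ℝ)|) with hS
  refine ⟨S, tsum_nonneg fun m ↦ by positivity, fun z hz ↦ ?_⟩
  refine tsum_of_norm_bounded (hs.hasSum.mul_right _) fun m ↦ ?_
  split_ifs with h0
  · rw [norm_zero]; positivity
  · refine (h _ b z h0 hz).trans ?_
    rw [mul_assoc C, mul_assoc C, ← Real.exp_add, ← Real.exp_add]
    gcongr
    have hm : (μ : ℝ) ≤ |((a + N * m : ℤ) : ℝ)| := by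
      exact_mod_cast (hμ m).resolve_left h0
    set x := |((a + N * m : ℤ) : ℝ)|
    have : -2 * Real.pi * x * z.im / N - (2 * Real.pi * μ / N + (-2 * Real.pi / N * x +
        -2 * Real.pi * μ * z.im / N)) = -(2 * Real.pi / N * ((x - μ) * (z.im - 1))) := by
      field_simp
      ring
    have h2 : 0 ≤ 2 * Real.pi / N * ((x - μ) * (z.im - 1)) := by
      have := Real.pi_pos
      have h3 : 0 ≤ x - μ := by linarith
      have h4 : 0 ≤ z.im - 1 := by linarith
      positivity
    linarith

lemma natAbs_valMinAbs_le_abs (N : ℕ) [NeZero N] (x : ZMod N) (c : ℤ) (hc : (c : ZMod N) = x) :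
    (x.valMinAbs.natAbs : ℤ) ≤ |c| := by
  have := ZMod.natAbs_min_of_le_div_two N x.valMinAbs c (by simp [hc]) (ZMod.natAbs_valMinAbs_le x)
  rw [Int.abs_eq_natAbs]
  exact_mod_cast this

/-- The decay of an Eisenstein series whose vectors never have a vanishing first entry. -/
lemma exists_norm_cubicEisenstein_le (N : ℕ) [NeZero N] (a b : ZMod N) (ha : a ≠ 0) :
    ∃ K : ℝ, 0 ≤ K ∧ ∀ z : ℍ, 1 ≤ z.im → ‖cubicEisenstein N ![a, b] z‖ ≤
      K * Real.exp (-2 * Real.pi * a.valMinAbs.natAbs * z.im / N) := by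
  obtain ⟨a', rfl⟩ := ZMod.intCast_surjective a
  obtain ⟨b', rfl⟩ := ZMod.intCast_surjective b
  have hne : ∀ m : ℤ, a' + N * m ≠ 0 := by
    intro m hm
    apply ha
    have := congrArg (Int.cast : ℤ → ZMod N) hm
    simpa using this
  obtain ⟨K, hK, h⟩ := exists_norm_tsum_row_le N a' b' (a' : ZMod N).valMinAbs.natAbs
    fun m ↦ .inr (natAbs_valMinAbs_le_abs N _ _ (by simp))
  refine ⟨K, hK, fun z hz ↦ ?_⟩
  rw [(cubicEisenstein_eq_tsum_row N a' b' z).2]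
  simpa [hne] using h z hz

/-- The limit at `i∞` of an Eisenstein series that contains vectors with vanishing first entry. -/
lemma tendsto_cubicEisenstein (N : ℕ) [NeZero N] (b : ℤ) :
    Tendsto (cubicEisenstein N ![0, b]) atImInfty (𝓝 (eisensteinRow N 0 b UpperHalfPlane.I)) := by
  have hN : (0 : ℝ) < N := Nat.cast_pos.mpr (NeZero.pos N)
  have hN' : (N : ℤ) ≠ 0 := Nat.cast_ne_zero.mpr (NeZero.ne N)
  obtain ⟨K, hK, h⟩ := exists_norm_tsum_row_le N 0 b 1 fun m ↦ by
    rcases eq_or_ne ((0 : ℤ) + N * m) 0 with h | h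
    · exact .inl h
    · exact .inr (by exact_mod_cast Int.one_le_abs h)
  rw [tendsto_iff_norm_sub_tendsto_zero]
  have hlim : Tendsto (fun z : ℍ ↦ K * Real.exp (-2 * Real.pi * (1 : ℕ) * z.im / N)) atImInfty
      (𝓝 0) := by
    rw [← mul_zero K]
    refine (Real.tendsto_exp_atBot.comp ?_).const_mul K
    have h1 : Tendsto (fun z : ℍ ↦ z.im) atImInfty atTop := tendsto_comap
    have h2 := h1.const_mul_atTop_of_neg (r := -2 * Real.pi / N)
      (div_neg_of_neg_of_pos (by linarith [Real.pi_pos]) hN)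
    refine h2.congr fun z ↦ ?_
    push_cast
    ring
  refine squeeze_zero' (.of_forall fun _ ↦ norm_nonneg _) ?_ hlim
  have hev : ∀ᶠ z : ℍ in atImInfty, 1 ≤ z.im := tendsto_comap.eventually (eventually_ge_atTop 1)
  filter_upwards [hev] with z hz
  have hrow := cubicEisenstein_eq_tsum_row N 0 b z
  rw [Int.cast_zero] at hrow
  have hI : eisensteinRow N 0 b UpperHalfPlane.I = eisensteinRow N (0 + N * 0) b z := by
    simp [eisensteinRow]
  rw [hrow.2, hrow.1.tsum_eq_add_tsum_ite 0, hI, add_sub_cancel_left]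
  refine le_of_eq_of_le ?_ (h z hz)
  congr 1
  refine tsum_congr fun m ↦ ?_
  simp only [zero_add, mul_eq_zero, hN', false_or]

/-- For `0 < j < N / 2` the positive terms of `∑ (j + N n)⁻³` dominate the negative ones. -/
lemma eisensteinRow_zero_ne_zero (N : ℕ) (j : ℕ) (hj : 0 < j) (hjN : 2 * j < N) (z : ℍ) :
    eisensteinRow N 0 j z ≠ 0 := by
  have hN : (0 : ℝ) < N := by exact_mod_cast (by omega : 0 < N)
  have hsumC : Summable fun n : ℤ ↦ 1 / (((j : ℤ) : ℂ) + N * n) ^ 3 := by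
    have h0 := (linear_right_summable ((j : ℂ) / N) 1 (k := 3) (by norm_num)).mul_left
      (((N : ℂ) ^ 3)⁻¹)
    refine h0.congr fun n ↦ ?_
    have hN' : (N : ℂ) ≠ 0 := by exact_mod_cast hN.ne'
    rw [← mul_inv, one_div, zpow_ofNat, ← mul_pow]
    congr 2
    push_cast
    field_simp
  set f : ℤ → ℝ := fun n ↦ 1 / ((j : ℝ) + N * n) ^ 3 with hf
  have hcast : ∀ n : ℤ, 1 / (((j : ℤ) : ℂ) + N * n) ^ 3 = ((f n : ℝ) : ℂ) := by
    intro n; simp [hf]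
  have hsum : Summable f := by
    simp_rw [hcast] at hsumC
    exact Complex.summable_ofReal.mp hsumC
  have hrow : eisensteinRow N 0 j z = ((∑' n, f n : ℝ) : ℂ) := by
    rw [Complex.ofReal_tsum, eisensteinRow]
    refine tsum_congr fun n ↦ ?_
    rw [← hcast]; simp
  have h1 : Summable fun n : ℕ ↦ f n := hsum.comp_injective Nat.cast_injective
  have h2 : Summable fun n : ℕ ↦ f (-(n + 1)) :=
    hsum.comp_injective (i := fun n : ℕ ↦ (-(n + 1) : ℤ)) fun x y hxy ↦ by
      simpa using hxy
  have hpos : ∀ n : ℕ, 0 < f n + f (-(n + 1)) := by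
    intro n
    have hj' : (0 : ℝ) < j := by exact_mod_cast hj
    have hjN' : 2 * (j : ℝ) < N := by exact_mod_cast hjN
    have hx : (0 : ℝ) < j + N * n := by positivity
    have hxy : (j : ℝ) + N * n < N * (n + 1) - j := by linarith
    have e : f (-(n + 1)) = - (1 / ((N : ℝ) * (n + 1) - j) ^ 3) := by
      simp only [hf]
      push_cast
      rw [show (j : ℝ) + N * (-(n + 1)) = -((N : ℝ) * (n + 1) - j) by ring,
        Odd.neg_pow (by decide), one_div, one_div, inv_neg]
    rw [e]
    have : 1 / ((N : ℝ) * (n + 1) - j) ^ 3 < f n := by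
      simp only [hf]
      push_cast
      gcongr
    linarith
  rw [hrow, tsum_of_nat_of_neg_add_one h1 h2, ← h1.tsum_add h2]
  exact_mod_cast ((h1.add h2).tsum_pos (fun n ↦ (hpos n).le) 0 (hpos 0)).ne'

/-! ### Modular and cusp forms for `Γ₁(N)` as sets of functions -/

section Membership

variable {N : ℕ} [NeZero N] {k : ℤ} {f : ℍ → ℂ}

lemma forall_cusps_iff (P : OnePoint ℝ → Prop) :
    (∀ c, IsCusp c (Gamma1 N : Subgroup (GL (Fin 2) ℝ)) → P c) ↔
      ∀ γ : SL(2, ℤ), P (Matrix.SpecialLinearGroup.mapGL ℝ γ • OnePoint.infty) := by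
  simp_rw [Subgroup.IsArithmetic.isCusp_iff_isCusp_SL2Z, isCusp_SL2Z_iff']
  constructor
  · exact fun h γ ↦ h _ ⟨γ, rfl⟩
  · rintro h _ ⟨γ, rfl⟩
    exact h γ

/-- Membership in `M_k(Γ₁(N))` in terms of the translates by `SL(2, ℤ)`. -/
lemma mem_modularFormSet_iff :
    f ∈ modularFormSet (Gamma1 N) k ↔
      (∀ γ ∈ Gamma1 N, ∀ z, f (γ • z) = denom γ z ^ k * f z) ∧
      DifferentiableOn ℂ (f ∘ ofComplex) {z : ℂ | 0 < z.im} ∧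
      ∀ γ : SL(2, ℤ), IsBoundedAtImInfty (f ∣[k] γ) := by
  have hb : (∀ c, IsCusp c (Gamma1 N : Subgroup (GL (Fin 2) ℝ)) → c.IsBoundedAt f k) ↔
      ∀ γ : SL(2, ℤ), IsBoundedAtImInfty (f ∣[k] γ) := by
    rw [forall_cusps_iff]
    exact forall_congr' fun γ ↦ OnePoint.isBoundedAt_iff rfl
  constructor
  · rintro ⟨F, rfl⟩
    refine ⟨fun γ hγ z ↦ ?_, mdifferentiable_iff.mp F.holo', hb.mp fun c hc ↦ F.bdd_at_cusps' hc⟩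
    have := congrFun (F.slash_action_eq' _ (Subgroup.mem_map_of_mem _ hγ)) z
    exact (slash_action_eq'_iff k F γ z).mp this |>.trans (by rw [denom_SL])
  · rintro ⟨h1, h2, h3⟩
    refine ⟨{ toFun := f, slash_action_eq' := ?_, holo' := mdifferentiable_iff.mpr h2,
              bdd_at_cusps' := fun {c} hc ↦ hb.mpr h3 c hc }, rfl⟩
    rintro _ ⟨γ, hγ, rfl⟩
    ext z
    refine (slash_action_eq'_iff k f γ z).mpr ?_
    rw [h1 γ hγ, denom_SL]

/-- Membership in `S_k(Γ₁(N))` in terms of the translates by `SL(2, ℤ)`. -/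
lemma mem_cuspFormSet_iff :
    f ∈ cuspFormSet (Gamma1 N) k ↔
      (∀ γ ∈ Gamma1 N, ∀ z, f (γ • z) = denom γ z ^ k * f z) ∧
      DifferentiableOn ℂ (f ∘ ofComplex) {z : ℂ | 0 < z.im} ∧
      ∀ γ : SL(2, ℤ), IsZeroAtImInfty (f ∣[k] γ) := by
  have hb : (∀ c, IsCusp c (Gamma1 N : Subgroup (GL (Fin 2) ℝ)) → c.IsZeroAt f k) ↔
      ∀ γ : SL(2, ℤ), IsZeroAtImInfty (f ∣[k] γ) := by
    rw [forall_cusps_iff]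
    exact forall_congr' fun γ ↦ OnePoint.isZeroAt_iff rfl
  constructor
  · rintro ⟨F, rfl⟩
    refine ⟨fun γ hγ z ↦ ?_, mdifferentiable_iff.mp F.holo', hb.mp fun c hc ↦ F.zero_at_cusps' hc⟩
    have := congrFun (F.slash_action_eq' _ (Subgroup.mem_map_of_mem _ hγ)) z
    exact (slash_action_eq'_iff k F γ z).mp this |>.trans (by rw [denom_SL])
  · rintro ⟨h1, h2, h3⟩
    refine ⟨{ toFun := f, slash_action_eq' := ?_, holo' := mdifferentiable_iff.mpr h2,
              zero_at_cusps' := fun {c} hc ↦ hb.mpr h3 c hc }, rfl⟩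
    rintro _ ⟨γ, hγ, rfl⟩
    ext z
    refine (slash_action_eq'_iff k f γ z).mpr ?_
    rw [h1 γ hγ, denom_SL]

end Membership

/-! ### Exponential order at infinity -/

section Growth

variable {F : ℍ → ℂ} {t : ℝ}

/-- The absolute value of `F` is asymptotic to a positive multiple of `exp (-t y / 2)` at `i∞`,
where `y` is the imaginary part. -/
def HasExpOrder (F : ℍ → ℂ) (t : ℝ) : Prop :=
  ∃ C : ℝ, 0 < C ∧ Tendsto (fun z : ℍ ↦ ‖F z‖ ^ 2 * Real.exp (t * z.im)) atImInfty (𝓝 C)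

lemma tendsto_im_atImInfty : Tendsto UpperHalfPlane.im atImInfty atTop := tendsto_comap

lemma eventually_le_im (A : ℝ) : ∀ᶠ z : ℍ in atImInfty, A ≤ z.im :=
  tendsto_im_atImInfty.eventually (eventually_ge_atTop A)

lemma HasExpOrder.isBoundedAtImInfty_iff (h : HasExpOrder F t) :
    IsBoundedAtImInfty F ↔ 0 ≤ t := by
  obtain ⟨C, hC, h⟩ := h
  constructor
  · intro hb
    by_contra! ht
    rw [UpperHalfPlane.isBoundedAtImInfty_iff] at hb
    obtain ⟨M, A, hM⟩ := hb
    have hexp : Tendsto (fun z : ℍ ↦ M ^ 2 * Real.exp (t * z.im)) atImInfty (𝓝 0) := by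
      rw [← mul_zero (M ^ 2)]
      exact (Real.tendsto_exp_atBot.comp
        (tendsto_im_atImInfty.const_mul_atTop_of_neg ht)).const_mul _
    have h0 := squeeze_zero' (.of_forall fun z ↦ by positivity) (by
      filter_upwards [eventually_le_im A] with z hz
      gcongr
      exact hM z hz) hexp (f := fun z : ℍ ↦ ‖F z‖ ^ 2 * Real.exp (t * z.im))
    exact hC.ne (tendsto_nhds_unique h0 h)
  · intro ht
    refine Asymptotics.IsBigO.of_bound (Real.sqrt (C + 1)) ?_
    filter_upwards [eventually_le_im 0, h.eventually_le_const (lt_add_one C)] with z hz hle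
    rw [Pi.one_apply, norm_one, mul_one]
    refine Real.le_sqrt_of_sq_le (le_trans ?_ hle)
    exact le_mul_of_one_le_right (by positivity) (Real.one_le_exp (by positivity))

lemma HasExpOrder.isZeroAtImInfty_iff (h : HasExpOrder F t) :
    IsZeroAtImInfty F ↔ 0 < t := by
  obtain ⟨C, hC, h⟩ := h
  constructor
  · intro hz
    by_contra! ht
    have h1 : Tendsto (fun z : ℍ ↦ ‖F z‖ ^ 2) atImInfty (𝓝 0) := by
      simpa using (Tendsto.norm hz).pow 2
    have h0 := squeeze_zero' (.of_forall fun z ↦ by positivity) (by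
      filter_upwards [eventually_le_im 0] with z hz
      exact mul_le_of_le_one_right (by positivity) (Real.exp_le_one_iff.mpr
        (mul_nonpos_of_nonpos_of_nonneg ht hz))) h1
        (f := fun z : ℍ ↦ ‖F z‖ ^ 2 * Real.exp (t * z.im))
    exact hC.ne (tendsto_nhds_unique h0 h)
  · intro ht
    have hexp : Tendsto (fun z : ℍ ↦ Real.exp (-t * z.im)) atImInfty (𝓝 0) :=
      Real.tendsto_exp_atBot.comp (tendsto_im_atImInfty.const_mul_atTop_of_neg (by linarith))
    have h1 := h.mul hexp
    rw [mul_zero] at h1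
    have h2 := (Real.continuous_sqrt.tendsto 0).comp h1
    rw [Real.sqrt_zero] at h2
    refine tendsto_zero_iff_norm_tendsto_zero.mpr (h2.congr fun z ↦ ?_)
    rw [Function.comp_apply, mul_assoc, ← Real.exp_add, neg_mul, add_neg_cancel, Real.exp_zero,
      mul_one, Real.sqrt_sq (norm_nonneg _)]

end Growth

/-! ### Products of powers of `η(z)` and `η(p z)` -/

section EtaPair

/-- The function `η(z) ^ a * η(p z) ^ b`. -/
noncomputable def etaPair (p : ℕ) (a b : ℤ) (z : ℍ) : ℂ :=
  eta z ^ a * eta ((p : ℂ) * z) ^ b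

variable (p : ℕ)

lemma tendsto_norm_eta_sq :
    Tendsto (fun z : ℍ ↦ ‖eta z‖ ^ 2 * Real.exp (Real.pi / 6 * z.im)) atImInfty (𝓝 1) := by
  have h := (tendsto_atImInfty_tprod_one_sub_eta_q_pow.norm).rpow_const (p := (1 / 12 : ℝ))
    (.inl (by simp))
  rw [norm_one, Real.one_rpow] at h
  refine h.congr fun z ↦ ?_
  rw [(multipliableLocallyUniformlyOn_eta.multipliable z.2).tprod_pow, eta, norm_mul, mul_pow,
    norm_pow]
  have h1 : ‖Function.Periodic.qParam 24 z‖ ^ 2 * Real.exp (Real.pi / 6 * z.im) = 1 := by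
    rw [Function.Periodic.norm_qParam, ← Real.exp_nat_mul, ← Real.exp_add, Real.exp_eq_one_iff]
    push_cast
    rw [coe_im]
    ring
  have h2 : ∀ x : ℝ, 0 ≤ x → (x ^ 24) ^ (1 / 12 : ℝ) = x ^ 2 := by
    intro x hx
    rw [show x ^ 24 = (x ^ 2) ^ 12 by ring, one_div]
    exact_mod_cast Real.pow_rpow_inv_natCast (n := 12) (sq_nonneg x) (by norm_num)
  rw [h2 _ (norm_nonneg _)]
  linear_combination -(‖∏' (n : ℕ), (1 - eta_q n (z : ℂ))‖ ^ 2) * h1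

lemma norm_etaPair_sq [NeZero p] (a b : ℤ) (z : ℍ) :
    ‖etaPair p a b z‖ ^ 2 = (‖eta z‖ ^ 2) ^ a * (‖eta (scale p z)‖ ^ 2) ^ b := by
  rw [etaPair, norm_mul, norm_zpow, norm_zpow, mul_pow, coe_scale]
  congr 1 <;> rw [← zpow_natCast, ← zpow_natCast, zpow_comm]

lemma etaPair_ne_zero [NeZero p] (a b : ℤ) (z : ℍ) : etaPair p a b z ≠ 0 :=
  mul_ne_zero (zpow_ne_zero _ (eta_ne_zero z.2)) (zpow_ne_zero _ (eta_ne_zero (scale p z).2))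

lemma differentiableOn_etaPair [NeZero p] (a b : ℤ) :
    DifferentiableOn ℂ (etaPair p a b ∘ ofComplex) {z : ℂ | 0 < z.im} := by
  have h : DifferentiableOn ℂ (fun z : ℂ ↦ eta z ^ a * eta ((p : ℂ) * z) ^ b)
      {z : ℂ | 0 < z.im} := by
    intro z hz
    have hz' : 0 < ((p : ℂ) * z).im := (scale p ⟨z, hz⟩).2
    refine (DifferentiableAt.mul ?_ ?_).differentiableWithinAt
    · exact (differentiableAt_eta_of_mem_upperHalfPlaneSet hz).zpow (.inl (eta_ne_zero hz))
    · refine DifferentiableAt.zpow ?_ (.inl (eta_ne_zero hz'))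
      exact (differentiableAt_eta_of_mem_upperHalfPlaneSet hz').comp z
        ((differentiableAt_id).const_mul _)
  refine h.congr fun z hz ↦ ?_
  simp [etaPair, ofComplex_apply_of_im_pos hz]

/-- On absolute values the multiplier system of `η` disappears, so that an eta pair transforms under
`Γ₀(p)` with weight `(a + b) / 2`. -/
lemma norm_etaPair_smul_sq [NeZero p] (a b : ℤ) (γ : SL(2, ℤ)) (h : (p : ℤ) ∣ γ 1 0) (z : ℍ) :
    ‖etaPair p a b (γ • z)‖ ^ 2 = ‖denom γ z‖ ^ (a + b) * ‖etaPair p a b z‖ ^ 2 := by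
  obtain ⟨γ', -, -, -, -, hγ'⟩ := exists_scale_smul_of_dvd p γ h
  have hd : ‖denom γ z‖ ≠ 0 := norm_ne_zero_iff.mpr (UpperHalfPlane.denom_ne_zero γ z)
  rw [norm_etaPair_sq, norm_etaPair_sq, (hγ' z).1, norm_eta_smul_sq, norm_eta_smul_sq, (hγ' z).2,
    mul_zpow, mul_zpow, zpow_add₀ hd]
  ring

/-- Outside `Γ₀(p)` the factor `η(p z)` becomes a multiple of `η((z + j) / p)`. -/
lemma exists_norm_etaPair_smul_sq [hp : Fact p.Prime] (a b : ℤ) (γ : SL(2, ℤ))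
    (h : ¬ (p : ℤ) ∣ γ 1 0) :
    ∃ j : ℤ, ∀ z, ‖etaPair p a b (γ • z)‖ ^ 2 = ‖denom γ z‖ ^ (a + b) *
      ((p : ℝ) ^ (-b) * ((‖eta z‖ ^ 2) ^ a * (‖eta (shiftDiv p j z)‖ ^ 2) ^ b)) := by
  obtain ⟨γ', j, hγ'⟩ := exists_scale_smul_of_not_dvd p γ h
  refine ⟨j, fun z ↦ ?_⟩
  have hp0 : (p : ℝ) ≠ 0 := Nat.cast_ne_zero.mpr hp.out.ne_zero
  have hd : ‖denom γ z‖ ≠ 0 := norm_ne_zero_iff.mpr (UpperHalfPlane.denom_ne_zero γ z)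
  have hd' : ‖denom γ' (shiftDiv p j z)‖ = (p : ℝ)⁻¹ * ‖denom γ z‖ := by
    rw [← (hγ' z).2, norm_mul, Complex.norm_natCast, inv_mul_cancel_left₀ hp0]
  rw [norm_etaPair_sq, (hγ' z).1, norm_eta_smul_sq, norm_eta_smul_sq, hd', mul_zpow, mul_zpow,
    mul_zpow, zpow_add₀ hd, inv_zpow, zpow_neg]
  ring

/-- The order of `η(z) ^ a * η(p z) ^ b` at the cusp `γ ∞`, in units where `η` has order `1` at
`i∞`. -/
noncomputable def etaPairOrder (a b : ℤ) (γ : SL(2, ℤ)) : ℝ :=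
  open Classical in if (p : ℤ) ∣ γ 1 0 then a + b * p else a + b / p

lemma tendsto_scale [NeZero p] : Tendsto (scale p) atImInfty atImInfty := by
  have hp : (0 : ℝ) < p := Nat.cast_pos.mpr (NeZero.pos p)
  refine tendsto_comap_iff.mpr ?_
  simpa [Function.comp_def] using
    tendsto_im_atImInfty.const_mul_atTop hp

lemma tendsto_shiftDiv [NeZero p] (j : ℤ) : Tendsto (shiftDiv p j) atImInfty atImInfty := by
  have hp : (0 : ℝ) < p := Nat.cast_pos.mpr (NeZero.pos p)
  refine tendsto_comap_iff.mpr ?_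
  simpa [Function.comp_def] using
    tendsto_im_atImInfty.atTop_div_const hp

lemma hasExpOrder_etaPair_slash [hp : Fact p.Prime] (a b k : ℤ) (hk : a + b = 2 * k)
    (γ : SL(2, ℤ)) :
    HasExpOrder (etaPair p a b ∣[k] γ) (Real.pi / 6 * etaPairOrder p a b γ) := by
  have hpos : (0 : ℝ) < p := Nat.cast_pos.mpr hp.out.pos
  have hslash : ∀ z, ‖(etaPair p a b ∣[k] γ) z‖ ^ 2 =
      (‖denom γ z‖ ^ (a + b))⁻¹ * ‖etaPair p a b (γ • z)‖ ^ 2 := by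
    intro z
    rw [SL_slash_apply, norm_mul, norm_zpow, mul_pow, hk, zpow_neg, inv_pow, ← zpow_natCast _ 2,
      ← zpow_natCast _ 2, ← zpow_mul, mul_comm k, mul_comm]
    rfl
  have hd : ∀ z : ℍ, ‖denom γ z‖ ^ (a + b) ≠ 0 := fun z ↦
    zpow_ne_zero _ (norm_ne_zero_iff.mpr (UpperHalfPlane.denom_ne_zero γ z))
  -- both cases compare with `η(z) ^ a * η(w z) ^ b`, where `w` rescales imaginary parts
  have main : ∀ (w : ℍ → ℍ) (s D : ℝ), 0 < D → Tendsto w atImInfty atImInfty →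
      (∀ z, (w z).im = s * z.im) →
      Tendsto (fun z : ℍ ↦ (D * ((‖eta z‖ ^ 2) ^ a * (‖eta (w z)‖ ^ 2) ^ b)) *
        Real.exp (Real.pi / 6 * (a + b * s) * z.im)) atImInfty (𝓝 D) := by
    intro w s D hD hw hs
    have h1 := (tendsto_norm_eta_sq.zpow₀ a (.inl one_ne_zero))
    have h2 := ((tendsto_norm_eta_sq.comp hw).zpow₀ b (.inl one_ne_zero))
    have h3 := (h1.mul h2).const_mul D
    simp only [one_zpow, mul_one] at h3
    refine h3.congr fun z ↦ ?_
    have hexp : ∀ (x : ℝ) (n : ℤ), Real.exp x ^ n = Real.exp (n * x) := fun x n ↦ by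
      rw [mul_comm, Real.exp_mul, Real.rpow_intCast]
    simp only [Function.comp, hs, mul_zpow, hexp]
    have : Real.exp (Real.pi / 6 * (a + b * s) * z.im) =
        Real.exp (a * (Real.pi / 6 * z.im)) * Real.exp (b * (Real.pi / 6 * (s * z.im))) := by
      rw [← Real.exp_add]; congr 1; ring
    rw [this]
    ring
  by_cases h : (p : ℤ) ∣ γ 1 0
  · refine ⟨1, one_pos, ?_⟩
    refine (main (scale p) p 1 one_pos (tendsto_scale p) (im_scale p)).congr fun z ↦ ?_
    rw [hslash, norm_etaPair_smul_sq p a b γ h, inv_mul_cancel_left₀ (hd z), norm_etaPair_sq,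
      etaPairOrder, if_pos h, one_mul]
  · obtain ⟨j, hj⟩ := exists_norm_etaPair_smul_sq p a b γ h
    refine ⟨(p : ℝ) ^ (-b), by positivity, ?_⟩
    refine (main (shiftDiv p j) (p : ℝ)⁻¹ _ (by positivity) (tendsto_shiftDiv p j) fun z ↦ by
      rw [im_shiftDiv]; ring).congr fun z ↦ ?_
    rw [hslash, hj, inv_mul_cancel_left₀ (hd z), etaPairOrder, if_neg h, ← div_eq_mul_inv]

end EtaPair

/-! ### A product of Eisenstein series with the divisor of an eta quotient -/

section Product

variable (p : ℕ)

/-- The product of the Eisenstein series `cubicEisenstein p (0, j)` over `0 < j ≤ p / 2`. -/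
noncomputable def eisensteinProduct (z : ℍ) : ℂ :=
  ∏ j ∈ Finset.Ico 1 (p / 2).succ, cubicEisenstein p ![0, (j : ZMod p)] z

/-- The translate of `eisensteinProduct` by `γ`: the product of the Eisenstein series attached to
the vectors `(0, j) γ`. -/
noncomputable def eisensteinProductTranslate (γ : SL(2, ℤ)) (z : ℍ) : ℂ :=
  ∏ j ∈ Finset.Ico 1 (p / 2).succ,
    cubicEisenstein p ![(j : ZMod p) * γ 1 0, (j : ZMod p) * γ 1 1] z

lemma eisensteinProduct_smul (γ : SL(2, ℤ)) (z : ℍ) :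
    eisensteinProduct p (γ • z) =
      (denom γ z ^ 3) ^ (p / 2) * eisensteinProductTranslate p γ z := by
  have h : ∀ j ∈ Finset.Ico 1 (p / 2).succ, cubicEisenstein p ![0, (j : ZMod p)] (γ • z) =
      denom γ z ^ 3 * cubicEisenstein p ![(j : ZMod p) * γ 1 0, (j : ZMod p) * γ 1 1] z :=
    fun j _ ↦ cubicEisenstein_smul p _ _ γ (by simp) (by simp) z
  rw [eisensteinProduct, Finset.prod_congr rfl h, Finset.prod_mul_distrib, Finset.prod_const]
  simp [eisensteinProductTranslate]

lemma eisensteinProduct_smul_of_mem (γ : SL(2, ℤ)) (hγ : γ ∈ Gamma1 p) (z : ℍ) :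
    eisensteinProduct p (γ • z) = (denom γ z ^ 3) ^ (p / 2) * eisensteinProduct p z := by
  obtain ⟨-, h11, h10⟩ := (Gamma1_mem p γ).mp hγ
  rw [eisensteinProduct_smul, eisensteinProductTranslate, eisensteinProduct]
  simp [h11, h10]

lemma differentiableOn_eisensteinProduct :
    DifferentiableOn ℂ (eisensteinProduct p ∘ ofComplex) {z : ℂ | 0 < z.im} := by
  simpa [eisensteinProduct, Function.comp_def] using DifferentiableOn.fun_finsetProd
    (u := Finset.Ico 1 (p / 2).succ)
    (f := fun j z ↦ cubicEisenstein p ![0, (j : ZMod p)] (ofComplex z))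
    fun j _ ↦ differentiableOn_cubicEisenstein p _

variable [hp : Fact p.Prime]

lemma eight_mul_sum_Ico (m : ℕ) : 8 * ∑ i ∈ Finset.Ico 1 m.succ, i = (2 * m + 1) ^ 2 - 1 := by
  have : ∀ m : ℕ, 8 * ∑ i ∈ Finset.Ico 1 m.succ, i + 1 = (2 * m + 1) ^ 2 := by
    intro m
    induction m with
    | zero => simp
    | succ n ih => rw [Finset.sum_Ico_succ_top (by omega), mul_add]; linarith
  have := this m
  omega

/-- At a cusp over `0` the orders of the factors are the absolutely least residues of
`c, 2 c, …`, which Gauss's permutation argument identifies with `1, …, (p - 1) / 2`. -/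
lemma exists_norm_eisensteinProductTranslate_le_of_not_dvd (hodd : Odd p) (γ : SL(2, ℤ))
    (h : ¬ (p : ℤ) ∣ γ 1 0) :
    ∃ K : ℝ, 0 ≤ K ∧ ∀ z : ℍ, 1 ≤ z.im → ‖eisensteinProductTranslate p γ z‖ ^ 8 ≤
      K * Real.exp (-2 * Real.pi * (p ^ 2 - 1) * z.im / p) := by
  have hc : (γ 1 0 : ZMod p) ≠ 0 := by rwa [Ne, ZMod.intCast_zmod_eq_zero_iff_dvd]
  have hne : ∀ j ∈ Finset.Ico 1 (p / 2).succ, (j : ZMod p) * γ 1 0 ≠ 0 := by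
    intro j hj
    rw [Finset.mem_Ico] at hj
    refine mul_ne_zero ?_ hc
    rw [Ne, ZMod.natCast_eq_zero_iff]
    intro hdvd
    have := Nat.le_of_dvd (by omega) hdvd
    omega
  have hK : ∀ j, ∃ K : ℝ, 0 ≤ K ∧ (j ∈ Finset.Ico 1 (p / 2).succ → ∀ z : ℍ, 1 ≤ z.im →
      ‖cubicEisenstein p ![(j : ZMod p) * γ 1 0, (j : ZMod p) * γ 1 1] z‖ ≤
      K * Real.exp (-2 * Real.pi * ((j : ZMod p) * γ 1 0).valMinAbs.natAbs * z.im / p)) := by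
    intro j
    by_cases hj : j ∈ Finset.Ico 1 (p / 2).succ
    · obtain ⟨K, hK, h⟩ := exists_norm_cubicEisenstein_le p _ ((j : ZMod p) * γ 1 1) (hne j hj)
      exact ⟨K, hK, fun _ ↦ h⟩
    · exact ⟨0, le_rfl, fun h ↦ absurd h hj⟩
  choose K hK0 hK using hK
  have hsum : ∑ j ∈ Finset.Ico 1 (p / 2).succ, ((j : ZMod p) * γ 1 0).valMinAbs.natAbs =
      ∑ j ∈ Finset.Ico 1 (p / 2).succ, j := by
    have := congrArg Multiset.sum (ZMod.Ico_map_valMinAbs_natAbs_eq_Ico_map_id p _ hc)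
    simpa only [Finset.sum_eq_multiset_sum, mul_comm] using this
  have h8 : (8 : ℝ) * ∑ j ∈ Finset.Ico 1 (p / 2).succ,
      (((j : ZMod p) * γ 1 0).valMinAbs.natAbs : ℝ) = p ^ 2 - 1 := by
    have e := eight_mul_sum_Ico (p / 2)
    rw [Nat.two_mul_div_two_add_one_of_odd hodd, ← hsum] at e
    have h1 : 1 ≤ p ^ 2 := Nat.one_le_pow _ _ hp.out.pos
    rw [← Nat.cast_sum, eq_sub_iff_add_eq]
    generalize ∑ j ∈ Finset.Ico 1 (p / 2).succ, ((j : ZMod p) * γ 1 0).valMinAbs.natAbs = S at e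
    have e' : 8 * S + 1 = p ^ 2 := by omega
    exact_mod_cast e'
  refine ⟨(∏ j ∈ Finset.Ico 1 (p / 2).succ, K j) ^ 8,
    pow_nonneg (Finset.prod_nonneg fun j _ ↦ hK0 j) 8, fun z hz ↦ ?_⟩
  have h1 : ‖eisensteinProductTranslate p γ z‖ ≤ ∏ j ∈ Finset.Ico 1 (p / 2).succ,
      (K j * Real.exp (-2 * Real.pi * ((j : ZMod p) * γ 1 0).valMinAbs.natAbs * z.im / p)) := by
    rw [eisensteinProductTranslate, norm_prod]
    exact Finset.prod_le_prod (fun _ _ ↦ norm_nonneg _) fun j hj ↦ hK j hj z hz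
  refine (pow_le_pow_left₀ (norm_nonneg _) h1 8).trans (le_of_eq ?_)
  rw [Finset.prod_mul_distrib, mul_pow, ← Real.exp_sum, ← Real.exp_nat_mul, ← h8]
  congr 2
  rw [← Finset.sum_div, ← Finset.sum_mul, ← Finset.mul_sum]
  push_cast
  ring

lemma exists_norm_eisensteinProductTranslate_le_of_dvd (γ : SL(2, ℤ)) (h : (p : ℤ) ∣ γ 1 0) :
    ∃ K : ℝ, ∀ᶠ z : ℍ in atImInfty, ‖eisensteinProductTranslate p γ z‖ ≤ K := by
  have hc : (γ 1 0 : ZMod p) = 0 := by rwa [ZMod.intCast_zmod_eq_zero_iff_dvd]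
  have hlim := tendsto_finsetProd (Finset.Ico 1 (p / 2).succ) fun j _ ↦
    tendsto_cubicEisenstein p (j * γ 1 1)
  have hK := hlim.norm.eventually_le_const (lt_add_one _)
  generalize ‖∏ c ∈ Finset.Ico 1 (p / 2).succ, eisensteinRow p 0 (c * γ 1 1) UpperHalfPlane.I‖ + 1
    = K at hK
  exact ⟨K, hK.mono fun z hz ↦ by simpa [eisensteinProductTranslate, hc] using hz⟩

lemma eisensteinProduct_ne_zero (hodd : Odd p) : eisensteinProduct p ≠ 0 := by
  have hlim := tendsto_finsetProd (Finset.Ico 1 (p / 2).succ) fun j _ ↦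
    tendsto_cubicEisenstein p j
  intro h0
  have h1 : (fun z : ℍ ↦ ∏ j ∈ Finset.Ico 1 (p / 2).succ,
      cubicEisenstein p ![0, ((j : ℤ) : ZMod p)] z) = fun _ ↦ 0 := by
    rw [show (fun _ : ℍ ↦ (0 : ℂ)) = eisensteinProduct p from h0.symm]
    funext z
    simp [eisensteinProduct]
  rw [h1] at hlim
  have h2 := tendsto_nhds_unique hlim tendsto_const_nhds
  obtain ⟨j, hj, hj0⟩ := Finset.prod_eq_zero_iff.mp h2
  rw [Finset.mem_Ico] at hj
  refine eisensteinRow_zero_ne_zero p j (by omega) ?_ _ hj0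
  obtain ⟨m, hm⟩ := hodd
  omega

end Product

/-! ### Invariance of `η(z) ^ p / η(p z)` -/

section Invariance

variable (p : ℕ) [hp : Fact p.Prime]

/-- The cubic characters of `η(z) ^ (8 p)` and `η(p z) ^ 8` agree on `Γ₀(p)` for `p ≠ 3`. -/
lemma etaPair_smul_pow_eight (hp3 : 3 < p) (γ : SL(2, ℤ)) (h : (p : ℤ) ∣ γ 1 0) (z : ℍ) :
    etaPair p p (-1) (γ • z) ^ 8 =
      (denom γ z ^ ((p : ℤ) - 1)) ^ 4 * etaPair p p (-1) z ^ 8 := by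
  obtain ⟨γ', h00, h01, h10, h11, hγ'⟩ := exists_scale_smul_of_dvd p γ h
  have hp2 : (p : ZMod 3) ^ 2 = 1 := by
    have h3 : (p : ZMod 3) ≠ 0 := by
      rw [Ne, ZMod.natCast_eq_zero_iff]
      intro hd
      have := (Nat.prime_dvd_prime_iff_eq Nat.prime_three hp.out).mp hd
      omega
    generalize (p : ZMod 3) = x at h3
    revert x
    decide
  have hf : p • etaEighthExponent γ = etaEighthExponent γ' := by
    simp only [etaEighthExponent, h00, h01, h10, h11, nsmul_eq_mul]
    push_cast
    linear_combination ((γ 0 0 : ZMod 3) + γ 1 1) * γ' 1 0 * hp2 -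
      (p : ZMod 3) * (γ 0 1 : ZMod 3) * γ 1 1 * (γ' 1 0 : ZMod 3) ^ 2 * hp2
  have hd : denom γ z ≠ 0 := UpperHalfPlane.denom_ne_zero γ z
  have e1 := etaEighthTransform γ z
  have e2 := etaEighthTransform γ' (scale p z)
  rw [← (hγ' z).1, (hγ' z).2, ← hf, AddChar.map_nsmul_eq_pow] at e2
  have key : ∀ w : ℍ, etaPair p p (-1) w ^ 8 = (eta w ^ 8) ^ p / eta (scale p w) ^ 8 := by
    intro w
    rw [etaPair, zpow_natCast, zpow_neg_one, coe_scale, mul_pow, inv_pow, div_eq_mul_inv,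
      ← pow_mul, ← pow_mul, mul_comm p]
  rw [key, key, e1, e2, zpow_sub₀ hd, zpow_natCast, zpow_one]
  have hχ : (ZMod.stdAddChar (etaEighthExponent γ) : ℂ) ≠ 0 := by
    rw [← norm_ne_zero_iff, AddChar.norm_apply]; exact one_ne_zero
  have h8 : eta (scale p z) ≠ 0 := eta_ne_zero (scale p z).2
  field_simp
  ring

/-- The weight-`0` form `P ^ 8 / g ^ 24`, with `P` the Eisenstein product and
`g = η(z) ^ p / η(p z)`, has no poles, hence is constant. -/
lemma exists_eisensteinProduct_pow_eq (hp3 : 3 < p) :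
    ∃ c : ℂ, c ≠ 0 ∧ ∀ z, eisensteinProduct p z ^ 8 = c * etaPair p p (-1) z ^ 24 := by
  have hodd : Odd p := hp.out.odd_of_ne_two (by omega)
  obtain ⟨m, hm⟩ := hodd
  have hm2 : p / 2 = m := by omega
  have hpos : (0 : ℝ) < p := Nat.cast_pos.mpr hp.out.pos
  set g := etaPair p p (-1) with hg
  set R : ℍ → ℂ := fun z ↦ eisensteinProduct p z ^ 8 / g z ^ 24 with hR
  have hg0 : ∀ z, g z ≠ 0 := etaPair_ne_zero p _ _
  have hexp : (p : ℤ) - 1 = 2 * (m : ℤ) := by omega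
  have hmem : R ∈ modularFormSet (Gamma1 p) 0 := by
    rw [mem_modularFormSet_iff]
    refine ⟨fun γ hγ z ↦ ?_, ?_, fun γ ↦ ?_⟩
    · have hdvd : (p : ℤ) ∣ γ 1 0 := by
        rw [← ZMod.intCast_zmod_eq_zero_iff_dvd]
        exact ((Gamma1_mem p γ).mp hγ).2.2
      have hd : denom γ z ≠ 0 := UpperHalfPlane.denom_ne_zero γ z
      have h24 : g (γ • z) ^ 24 = (denom γ z) ^ (24 * m) * g z ^ 24 := by
        rw [show 24 = 8 * 3 from rfl, pow_mul, etaPair_smul_pow_eight p hp3 γ hdvd z, hexp,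
          zpow_mul, zpow_natCast, zpow_ofNat]
        ring
      simp only [hR]
      rw [eisensteinProduct_smul_of_mem p γ hγ, h24, hm2, zpow_zero, one_mul]
      have : ((denom γ z ^ 3) ^ m * eisensteinProduct p z) ^ 8 =
        denom γ z ^ (24 * m) * eisensteinProduct p z ^ 8 := by ring
      rw [this, mul_div_mul_left _ _ (pow_ne_zero _ hd)]
    · exact ((differentiableOn_eisensteinProduct p).pow 8).div
        ((differentiableOn_etaPair p p (-1)).pow 24) fun z _ ↦ pow_ne_zero _ (hg0 _)
    · -- compare both sides after normalising by the automorphy factor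
      have hnorm : ∀ z, ‖(R ∣[(0 : ℤ)] γ) z‖ =
          ‖eisensteinProductTranslate p γ z‖ ^ 8 / (‖(g ∣[(m : ℤ)] γ) z‖ ^ 2) ^ 12 := by
        intro z
        have hd : denom γ z ≠ 0 := UpperHalfPlane.denom_ne_zero γ z
        have hd' : ‖denom γ z‖ ≠ 0 := norm_ne_zero_iff.mpr hd
        have hgn : ‖g (γ • z)‖ ≠ 0 := norm_ne_zero_iff.mpr (hg0 _)
        rw [SL_slash_apply, SL_slash_apply, neg_zero, zpow_zero, mul_one]
        simp only [hR]
        rw [eisensteinProduct_smul, hm2, norm_div, norm_pow, norm_pow, norm_mul, norm_mul,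
          norm_pow, norm_pow, norm_zpow, zpow_neg, zpow_natCast]
        field_simp
        ring
      obtain ⟨C, hC, hlim⟩ := hasExpOrder_etaPair_slash p p (-1) m (by omega) γ
      have hlow := hlim.eventually_const_le (half_lt_self hC)
      have hbound : ∀ (K : ℝ) (z : ℍ), ‖eisensteinProductTranslate p γ z‖ ^ 8 ≤
          K * (Real.exp (Real.pi / 6 * etaPairOrder p p (-1) γ * z.im) ^ 12)⁻¹ →
          C / 2 ≤ ‖(g ∣[(m : ℤ)] γ) z‖ ^ 2 *
            Real.exp (Real.pi / 6 * etaPairOrder p p (-1) γ * z.im) →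
          ‖(R ∣[(0 : ℤ)] γ) z‖ ≤ K / (C / 2) ^ 12 := by
        intro K z h1 h2
        rw [hnorm]
        set E := Real.exp (Real.pi / 6 * etaPairOrder p p (-1) γ * z.im)
        have hE : 0 < E := Real.exp_pos _
        set X := ‖(g ∣[(m : ℤ)] γ) z‖ ^ 2
        have hX : 0 < X := pos_of_mul_pos_left (lt_of_lt_of_le (half_pos hC) h2) hE.le
        rw [div_le_div_iff₀ (by positivity) (by positivity)]
        have hK : 0 ≤ K := by
          have := le_trans (by positivity) h1
          exact nonneg_of_mul_nonneg_left this (by positivity)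
        calc _ ≤ K * (E ^ 12)⁻¹ * (X * E) ^ 12 := by gcongr
          _ = K * X ^ 12 := by field_simp
      by_cases h : (p : ℤ) ∣ γ 1 0
      · obtain ⟨K, hK⟩ := exists_norm_eisensteinProductTranslate_le_of_dvd p γ h
        refine Asymptotics.IsBigO.of_bound (K ^ 8 / (C / 2) ^ 12) ?_
        filter_upwards [hK, hlow] with z h1 h2
        rw [Pi.one_apply, norm_one, mul_one]
        refine hbound _ z ?_ h2
        have : etaPairOrder p p (-1) γ = 0 := by rw [etaPairOrder, if_pos h]; push_cast; ring
        rw [this]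
        simpa using pow_le_pow_left₀ (norm_nonneg _) h1 8
      · obtain ⟨K, -, hK⟩ :=
          exists_norm_eisensteinProductTranslate_le_of_not_dvd p ⟨m, hm⟩ γ h
        refine Asymptotics.IsBigO.of_bound (K / (C / 2) ^ 12) ?_
        filter_upwards [eventually_le_im 1, hlow] with z h1 h2
        rw [Pi.one_apply, norm_one, mul_one]
        refine hbound _ z ((hK z h1).trans (le_of_eq ?_)) h2
        rw [← Real.exp_nat_mul, ← Real.exp_neg, etaPairOrder, if_neg h]
        congr 2
        push_cast
        field_simp
        ring
  obtain ⟨F, hF⟩ := hmem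
  obtain ⟨c, hc⟩ := ModularForm.eq_const_of_weight_zero F
  have hRc : ∀ z, eisensteinProduct p z ^ 8 = c * g z ^ 24 := by
    intro z
    have : R z = c := by
      rw [← hF]
      exact congrFun hc z
    rw [← this, hR]
    have := hg0 z
    field_simp
  refine ⟨c, ?_, hRc⟩
  rintro rfl
  refine eisensteinProduct_ne_zero p ⟨m, hm⟩ (funext fun z ↦ ?_)
  have := hRc z
  rw [zero_mul] at this
  exact pow_eq_zero_iff (by norm_num) |>.mp this

/-- `P / g ^ 3` takes finitely many values, hence is constant on the connected set `ℍ`. -/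
lemma exists_eisensteinProduct_eq (hp3 : 3 < p) :
    ∃ c : ℂ, c ≠ 0 ∧ ∀ z, eisensteinProduct p z = c * etaPair p p (-1) z ^ 3 := by
  obtain ⟨c, hc, h⟩ := exists_eisensteinProduct_pow_eq p hp3
  set g := etaPair p p (-1)
  have hg0 : ∀ z, g z ≠ 0 := etaPair_ne_zero p _ _
  set q : ℍ → ℂ := fun z ↦ eisensteinProduct p z / g z ^ 3 with hq
  have hq8 : ∀ z, q z ^ 8 = c := by
    intro z
    have := hg0 z
    rw [hq, div_pow, h z]
    field_simp
  have hcont : Continuous q :=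
    ((mdifferentiable_iff.mpr (differentiableOn_eisensteinProduct p)).continuous).div
      (((mdifferentiable_iff.mpr (differentiableOn_etaPair p p (-1))).continuous).pow 3)
      fun z ↦ pow_ne_zero _ (hg0 z)
  have hfin : {x : ℂ | x ^ 8 = c}.Finite := by
    refine (Polynomial.nthRoots 8 c).toFinset.finite_toSet.subset fun x hx ↦ ?_
    simpa [Polynomial.mem_nthRoots] using hx
  have hconst : ∀ z, q z = q UpperHalfPlane.I := fun z ↦
    (isPreconnected_univ (α := ℍ)).constant_of_mapsTo hfin.isDiscrete hcont.continuousOn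
      (fun w _ ↦ hq8 w) (Set.mem_univ z) (Set.mem_univ _)
  refine ⟨q UpperHalfPlane.I, ?_, fun z ↦ ?_⟩
  · intro h0
    have := hq8 UpperHalfPlane.I
    rw [h0] at this
    exact hc (by simpa using this.symm)
  · rw [← hconst z, hq]
    have := hg0 z
    field_simp

/-- `η(z) ^ p / η(p z)` is invariant under `Γ₁(p)` in weight `(p - 1) / 2`, because its third and
its eighth powers are. -/
theorem etaPair_smul (hp3 : 3 < p) {m : ℕ} (hm : p = 2 * m + 1) (γ : SL(2, ℤ))
    (hγ : γ ∈ Gamma1 p) (z : ℍ) :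
    etaPair p p (-1) (γ • z) = denom γ z ^ m * etaPair p p (-1) z := by
  have hdvd : (p : ℤ) ∣ γ 1 0 := by
    rw [← ZMod.intCast_zmod_eq_zero_iff_dvd]
    exact ((Gamma1_mem p γ).mp hγ).2.2
  have hd : denom γ z ≠ 0 := UpperHalfPlane.denom_ne_zero γ z
  have h8 := etaPair_smul_pow_eight p hp3 γ hdvd z
  rw [show (p : ℤ) - 1 = 2 * (m : ℤ) by omega, zpow_mul, zpow_natCast, zpow_ofNat] at h8
  obtain ⟨c, hc, hP⟩ := exists_eisensteinProduct_eq p hp3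
  have h3 := eisensteinProduct_smul_of_mem p γ hγ z
  rw [hP, hP, show p / 2 = m by omega, mul_left_comm] at h3
  replace h3 := mul_left_cancel₀ hc h3
  have hg0 := etaPair_ne_zero p p (-1) z
  set x := etaPair p p (-1) (γ • z)
  set y := etaPair p p (-1) z
  have hy : (denom γ z ^ m * y) ≠ 0 := mul_ne_zero (pow_ne_zero _ hd) hg0
  have h8' : x ^ 8 = (denom γ z ^ m * y) ^ 8 := by rw [h8]; ring
  have h3' : x ^ 3 = (denom γ z ^ m * y) ^ 3 := by rw [h3]; ring
  set u := denom γ z ^ m * y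
  refine mul_right_cancel₀ (pow_ne_zero 8 hy) ?_
  calc x * u ^ 8 = (x ^ 3) ^ 3 := by rw [← h8']; ring
    _ = u * u ^ 8 := by rw [h3']; ring

end Invariance

/-! ### The Fricke involution -/

section Fricke

variable (p : ℕ) [hp : Fact p.Prime]

lemma sqrt_eq_exp_log {w : ℂ} (hw : w ≠ 0) : Complex.sqrt w = cexp (Complex.log w / 2) := by
  rw [Complex.sqrt, Complex.cpow_def_of_ne_zero hw, div_eq_mul_inv]

lemma eta_S_smul (z : ℍ) :
    eta ((ModularGroup.S • z : ℍ) : ℂ) =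
      (Complex.sqrt Complex.I)⁻¹ * (Complex.sqrt z * eta z) := by
  have h2 := eta_comp_eq_csqrt_I_inv z.2
  have h3 : ((-(z : ℂ))⁻¹) = -1 / (z : ℂ) := by rw [inv_neg, neg_div, one_div]
  rw [UpperHalfPlane.modular_S_smul]
  simpa [h3] using h2

lemma scale_S_smul_scale (z : ℍ) :
    scale p (ModularGroup.S • scale p z) = ModularGroup.S • z := by
  have hp0 : (p : ℂ) ≠ 0 := Nat.cast_ne_zero.mpr hp.out.ne_zero
  have hz := UpperHalfPlane.ne_zero z
  ext1
  rw [coe_scale, UpperHalfPlane.modular_S_smul, UpperHalfPlane.modular_S_smul]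
  simp only [coe_scale]
  field_simp

/-- The Fricke involution `z ↦ -1 / (p z)` exchanges the two basic eta quotients. -/
lemma exists_etaPair_fricke {m : ℕ} (hm : p = 2 * m + 1) :
    ∃ C : ℂ, C ≠ 0 ∧ ∀ z : ℍ, etaPair p p (-1) (ModularGroup.S • scale p z) =
      C * (z : ℂ) ^ m * etaPair p (-1) p z := by
  have hp0 : (0 : ℝ) < p := Nat.cast_pos.mpr hp.out.pos
  set κ := (Complex.sqrt Complex.I)⁻¹ with hκ
  have hκ0 : κ ≠ 0 := by
    rw [hκ, sqrt_eq_exp_log Complex.I_ne_zero]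
    exact inv_ne_zero (Complex.exp_ne_zero _)
  set s := cexp (((Real.log p : ℝ) : ℂ) / 2) with hs
  refine ⟨κ ^ (2 * m) * s ^ p, mul_ne_zero (pow_ne_zero _ hκ0)
    (pow_ne_zero _ (Complex.exp_ne_zero _)), fun z ↦ ?_⟩
  have hz := UpperHalfPlane.ne_zero z
  have hsqrt : Complex.sqrt ((p : ℂ) * z) = s * Complex.sqrt z := by
    have hpz : (p : ℂ) * z ≠ 0 := UpperHalfPlane.ne_zero (scale p z)
    have hlog := Complex.log_ofReal_mul hp0 hz
    rw [Complex.ofReal_natCast] at hlog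
    rw [sqrt_eq_exp_log hpz, sqrt_eq_exp_log hz, hlog, hs, ← Complex.exp_add]
    congr 1
    ring
  have hsq : Complex.sqrt z ^ 2 = z := by
    rw [sqrt_eq_exp_log hz, ← Complex.exp_nat_mul]
    push_cast
    rw [mul_div_cancel₀ _ two_ne_zero, Complex.exp_log hz]
  have hzm : (z : ℂ) ^ m = Complex.sqrt z ^ (2 * m) := by rw [pow_mul, hsq]
  have hs0 : Complex.sqrt z ≠ 0 := by
    intro h0
    rw [h0] at hsq
    exact hz (by simpa using hsq.symm)
  have hη : eta z ≠ 0 := eta_ne_zero z.2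
  rw [etaPair, etaPair, ← coe_scale, ← coe_scale, scale_S_smul_scale, eta_S_smul, eta_S_smul,
    zpow_natCast, zpow_natCast, zpow_neg_one, zpow_neg_one, coe_scale, hsqrt, ← hκ, hzm]
  generalize eta ((p : ℂ) * z) = e
  subst hm
  field_simp
  ring

/-- The invariance of `η(p z) ^ p / η(z)` under `Γ₁(p)`, transported by the Fricke involution. -/
theorem etaPair_smul' (hp3 : 3 < p) {m : ℕ} (hm : p = 2 * m + 1) (γ : SL(2, ℤ))
    (hγ : γ ∈ Gamma1 p) (z : ℍ) :
    etaPair p (-1) p (γ • z) = denom γ z ^ m * etaPair p (-1) p z := by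
  obtain ⟨h00, h11, hc⟩ := (Gamma1_mem p γ).mp hγ
  rw [ZMod.intCast_zmod_eq_zero_iff_dvd] at hc
  obtain ⟨γ', e00, e01, -, e11, hγ'⟩ := exists_scale_smul_of_dvd p γ hc
  have hp0 : (p : ℂ) ≠ 0 := Nat.cast_ne_zero.mpr hp.out.ne_zero
  set δ := ModularGroup.S * γ' * ModularGroup.S⁻¹ with hδ
  have hSinv : (ModularGroup.S⁻¹ : SL(2, ℤ)).1 = !![0, 1; -1, 0] := by
    rw [Matrix.SpecialLinearGroup.coe_inv, ModularGroup.coe_S, Matrix.adjugate_fin_two_of]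
    simp
  have hδmem : δ ∈ Gamma1 p := by
    rw [Gamma1_mem, hδ]
    simp only [Matrix.SpecialLinearGroup.coe_mul, hSinv, ModularGroup.coe_S, Matrix.mul_apply,
      Fin.sum_univ_two]
    simp [e00, e01, e11, h00, h11]
  obtain ⟨C, hC, hF⟩ := exists_etaPair_fricke p hm
  have hpt : δ • ModularGroup.S • scale p z = ModularGroup.S • scale p (γ • z) := by
    rw [(hγ' z).1, hδ, mul_smul, mul_smul, inv_smul_smul]
  have hden : denom δ ((ModularGroup.S • scale p z : ℍ) : ℂ) * z =
      ((γ • z : ℍ) : ℂ) * denom γ z := by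
    have e1 := denom_SL_mul δ ModularGroup.S (scale p z)
    have e2 := denom_SL_mul ModularGroup.S γ' (scale p z)
    rw [hδ, inv_mul_cancel_right, e2, ← hδ, ModularGroup.denom_S, ModularGroup.denom_S,
      (hγ' z).2, ← (hγ' z).1, coe_scale, coe_scale] at e1
    refine mul_left_cancel₀ hp0 ?_
    linear_combination -e1
  have h1 := etaPair_smul p hp3 hm δ hδmem (ModularGroup.S • scale p z)
  rw [hpt, hF, hF] at h1
  have hγz := UpperHalfPlane.ne_zero (γ • z)
  refine mul_left_cancel₀ (mul_ne_zero hC (pow_ne_zero m hγz)) ?_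
  rw [h1]
  calc _ = C * (denom δ ((ModularGroup.S • scale p z : ℍ) : ℂ) * z) ^ m *
        etaPair p (-1) p z := by ring
    _ = _ := by rw [hden]; ring

end Fricke

/-! ### Classification of the non-cuspidal eta quotients -/

section Classification

variable (p : ℕ)

lemma etaQuotient_eq_etaPair (hp : p.Prime) (r : ℕ → ℤ) :
    etaQuotient p r = etaPair p (r 1) (r p) := by
  funext z
  rw [etaQuotient, hp.divisors, Finset.prod_pair hp.one_lt.ne, etaPair]
  simp

lemma isEtaQuotient_iff (hp : p.Prime) (f : ℍ → ℂ) :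
    IsEtaQuotient p f ↔ ∃ a b : ℤ, f = etaPair p a b := by
  constructor
  · rintro ⟨r, rfl⟩
    exact ⟨_, _, etaQuotient_eq_etaPair p hp r⟩
  · rintro ⟨a, b, rfl⟩
    refine ⟨fun δ ↦ if δ = 1 then a else b, ?_⟩
    rw [etaQuotient_eq_etaPair p hp, if_pos rfl, if_neg hp.one_lt.ne']

lemma etaPair_mul_mul (a b n : ℤ) (z : ℍ) : etaPair p (a * n) (b * n) z = etaPair p a b z ^ n := by
  rw [etaPair, etaPair, mul_zpow, zpow_mul, zpow_mul]

lemma etaPairOrder_one (a b : ℤ) : etaPairOrder p a b 1 = a + b * p := by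
  simp [etaPairOrder]

variable [hp : Fact p.Prime]

lemma etaPair_mem_modularFormSet {a b k : ℤ} (hk : a + b = 2 * k)
    (hinv : ∀ γ ∈ Gamma1 p, ∀ z, etaPair p a b (γ • z) = denom γ z ^ k * etaPair p a b z)
    (h1 : (0 : ℝ) ≤ a + b * p) (h2 : (0 : ℝ) ≤ a + b / p) :
    etaPair p a b ∈ modularFormSet (Gamma1 p) k := by
  refine mem_modularFormSet_iff.mpr ⟨hinv, differentiableOn_etaPair p a b, fun γ ↦ ?_⟩
  rw [(hasExpOrder_etaPair_slash p a b k hk γ).isBoundedAtImInfty_iff]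
  refine mul_nonneg (by positivity) ?_
  rw [etaPairOrder]
  split_ifs <;> assumption

lemma etaPairOrder_S (a b : ℤ) : etaPairOrder p a b ModularGroup.S = a + b / p := by
  rw [etaPairOrder, if_neg]
  have : (ModularGroup.S : SL(2, ℤ)) 1 0 = 1 := by simp [ModularGroup.coe_S]
  rw [this]
  exact_mod_cast hp.out.one_lt.ne' ∘ Nat.dvd_one.mp

/-- The weight of an eta quotient that is a modular form is half the sum of the exponents, as one
sees from the action of `(1, 0; p, 1)` on absolute values. -/
lemma add_eq_two_mul_of_mem {a b k : ℤ} (h : etaPair p a b ∈ modularFormSet (Gamma1 p) k) :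
    a + b = 2 * k := by
  obtain ⟨hinv, -, -⟩ := mem_modularFormSet_iff.mp h
  obtain ⟨γ, hγ⟩ : ∃ γ : SL(2, ℤ), γ.1 = !![1, 0; (p : ℤ), 1] :=
    ⟨⟨_, by rw [Matrix.det_fin_two_of]; ring⟩, rfl⟩
  have h10 : γ 1 0 = p := by simp [hγ]
  have h11 : γ 1 1 = 1 := by simp [hγ]
  have hmem : γ ∈ Gamma1 p := by rw [Gamma1_mem]; simp [hγ]
  have e1 := norm_etaPair_smul_sq p a b γ (by simp [h10]) UpperHalfPlane.I
  rw [hinv γ hmem, norm_mul, norm_zpow, mul_pow] at e1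
  have hne : ‖etaPair p a b UpperHalfPlane.I‖ ^ 2 ≠ 0 :=
    pow_ne_zero _ (norm_ne_zero_iff.mpr (etaPair_ne_zero p a b _))
  have e2 := mul_right_cancel₀ hne e1
  have hd : 1 < ‖denom γ (UpperHalfPlane.I : ℂ)‖ := by
    have h1 := Complex.abs_im_le_norm (denom γ (UpperHalfPlane.I : ℂ))
    rw [denom_SL, h10, h11] at h1 ⊢
    have : (1 : ℝ) < p := by exact_mod_cast hp.out.one_lt
    simp at h1
    simp
    linarith
  rw [← zpow_natCast, ← zpow_mul] at e2
  have := zpow_right_injective₀ (by linarith) hd.ne' e2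
  push_cast at this
  linarith

theorem mem_nonCuspidalEtaQuotients_iff (hp3 : 3 < p) {m : ℕ} (hm : p = 2 * m + 1) {k : ℤ}
    (hk : 0 ≤ k) (f : ℍ → ℂ) :
    f ∈ nonCuspidalEtaQuotients p k ↔ ∃ n : ℤ, 0 ≤ n ∧ k = m * n ∧
      (f = etaPair p (p * n) (-n) ∨ f = etaPair p (-n) (p * n)) := by
  have hp0 : (0 : ℝ) < p := Nat.cast_pos.mpr hp.out.pos
  have hp1 : (1 : ℝ) < p := by exact_mod_cast hp.out.one_lt
  have hmR : (p : ℤ) = 2 * m + 1 := by exact_mod_cast hm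
  have hm0 : (0 : ℤ) < m := by omega
  constructor
  · rintro ⟨hq, hmem, hnot⟩
    obtain ⟨a, b, rfl⟩ := (isEtaQuotient_iff p hp.out f).mp hq
    have hw := add_eq_two_mul_of_mem p hmem
    obtain ⟨hinv, hdiff, hbdd⟩ := mem_modularFormSet_iff.mp hmem
    have hpi : 0 < Real.pi / 6 := by positivity
    have h1 := (hasExpOrder_etaPair_slash p a b k hw 1).isBoundedAtImInfty_iff.mp (hbdd _)
    have h2 := (hasExpOrder_etaPair_slash p a b k hw ModularGroup.S).isBoundedAtImInfty_iff.mp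
      (hbdd _)
    rw [mul_nonneg_iff_of_pos_left hpi] at h1 h2
    rw [etaPairOrder_one] at h1
    rw [etaPairOrder_S] at h2
    -- an eta quotient of positive order at both kinds of cusps would be a cusp form
    have h3 : (a : ℝ) + b * p = 0 ∨ (a : ℝ) + b / p = 0 := by
      by_contra! hcon
      refine hnot (mem_cuspFormSet_iff.mpr ⟨hinv, hdiff, fun γ ↦ ?_⟩)
      rw [(hasExpOrder_etaPair_slash p a b k hw γ).isZeroAtImInfty_iff]
      refine mul_pos hpi ?_
      rw [etaPairOrder]
      split_ifs
      · exact lt_of_le_of_ne h1 hcon.1.symm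
      · exact lt_of_le_of_ne h2 hcon.2.symm
    rcases h3 with h3 | h3
    · have h4 : a + b * p = 0 := by exact_mod_cast h3
      have h5 : k = m * -b := by rw [hmR] at h4; linarith
      refine ⟨-b, ?_, h5, .inl ?_⟩
      · rw [h5] at hk
        exact nonneg_of_mul_nonneg_right hk hm0
      · rw [show a = p * -b by linarith, neg_neg]
    · have h4 : a * p + b = 0 := by
        field_simp at h3
        exact_mod_cast h3
      have h5 : k = m * -a := by rw [hmR] at h4; linarith
      refine ⟨-a, ?_, h5, .inr ?_⟩
      · rw [h5] at hk
        exact nonneg_of_mul_nonneg_right hk hm0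
      · rw [show b = p * -a by linarith, neg_neg]
  · rintro ⟨n, hn, rfl, hf⟩
    have hnR : (0 : ℝ) ≤ n := by exact_mod_cast hn
    rcases hf with rfl | rfl
    · refine ⟨(isEtaQuotient_iff p hp.out _).mpr ⟨_, _, rfl⟩, ?_, fun hcusp ↦ ?_⟩
      · refine etaPair_mem_modularFormSet p (by rw [hmR]; ring) (fun γ hγ z ↦ ?_) ?_ ?_
        · have e := etaPair_mul_mul p p (-1) n
          rw [neg_one_mul] at e
          rw [e, e, etaPair_smul p hp3 hm γ hγ, mul_zpow, zpow_mul, zpow_natCast]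
        · push_cast; nlinarith
        · push_cast
          have : (p : ℝ) * n + -n / p = n * ((p ^ 2 - 1) / p) := by field_simp; ring
          rw [this]
          have : (0 : ℝ) ≤ p ^ 2 - 1 := by nlinarith
          positivity
      · have h0 := (mem_cuspFormSet_iff.mp hcusp).2.2 1
        rw [(hasExpOrder_etaPair_slash p _ _ _ (by rw [hmR]; ring) 1).isZeroAtImInfty_iff,
          etaPairOrder_one] at h0
        push_cast at h0
        ring_nf at h0
        exact lt_irrefl _ h0
    · refine ⟨(isEtaQuotient_iff p hp.out _).mpr ⟨_, _, rfl⟩, ?_, fun hcusp ↦ ?_⟩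
      · refine etaPair_mem_modularFormSet p (by rw [hmR]; ring) (fun γ hγ z ↦ ?_) ?_ ?_
        · have e := etaPair_mul_mul p (-1) p n
          rw [neg_one_mul] at e
          rw [e, e, etaPair_smul' p hp3 hm γ hγ, mul_zpow, zpow_mul, zpow_natCast]
        · push_cast
          have : (0 : ℝ) ≤ p ^ 2 - 1 := by nlinarith
          have : -(n : ℝ) + p * n * p = n * (p ^ 2 - 1) := by ring
          rw [this]
          positivity
        · push_cast
          field_simp
          simp
      · have h0 := (mem_cuspFormSet_iff.mp hcusp).2.2 ModularGroup.S
        rw [(hasExpOrder_etaPair_slash p _ _ _ (by rw [hmR]; ring) _).isZeroAtImInfty_iff,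
          etaPairOrder_S] at h0
        push_cast at h0
        rw [mul_div_cancel_left₀ _ hp0.ne', neg_add_cancel, mul_zero] at h0
        exact lt_irrefl _ h0

/-- The two eta quotients differ, since only one of them vanishes at `i∞`. -/
lemma etaPair_ne_etaPair (m : ℕ) (hm : p = 2 * m + 1) {n : ℤ} (hn : 0 < n) :
    etaPair p (-n) (p * n) ≠ etaPair p (p * n) (-n) := by
  have hmR : (p : ℤ) = 2 * m + 1 := by exact_mod_cast hm
  have hp1 : (1 : ℝ) < p := by exact_mod_cast hp.out.one_lt
  have hnR : (0 : ℝ) < n := by exact_mod_cast hn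
  intro h
  have h1 := (hasExpOrder_etaPair_slash p (-n) (p * n) (m * n)
    (by rw [hmR]; ring) 1).isZeroAtImInfty_iff
  have h2 := (hasExpOrder_etaPair_slash p (p * n) (-n) (m * n)
    (by rw [hmR]; ring) 1).isZeroAtImInfty_iff
  rw [h, h2, etaPairOrder_one, etaPairOrder_one] at h1
  have h3 : ¬ 0 < Real.pi / 6 * (((p * n : ℤ) : ℝ) + ((-n : ℤ) : ℝ) * p) := by
    push_cast; ring_nf; simp
  refine h3 (h1.mpr (mul_pos (by positivity) ?_))
  push_cast
  have : -(n : ℝ) + p * n * p = n * (p ^ 2 - 1) := by ring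
  rw [this]
  exact mul_pos hnR (by nlinarith)

end Classification

end EtaQuotients

theorem mainTheorem2 (p : ℕ) (hp : p.Prime) (hp3 : 3 < p) (k : ℤ) (hk : 0 ≤ k) :
    ((nonCuspidalEtaQuotients p k).Nonempty ↔ ((p : ℤ) - 1) / 2 ∣ k) ∧
    (0 < k → ((p : ℤ) - 1) / 2 ∣ k →
      nonCuspidalEtaQuotients p k = {etaQuotientOne p k, etaQuotientTwo p k} ∧
      etaQuotientOne p k ≠ etaQuotientTwo p k) := by
  have : Fact p.Prime := ⟨hp⟩
  obtain ⟨m, hm⟩ := hp.odd_of_ne_two (by omega)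
  have hm0 : (0 : ℤ) < m := by omega
  have hhalf : ((p : ℤ) - 1) / 2 = m := by omega
  have hmR : (p : ℤ) - 1 = 2 * m := by omega
  rw [hhalf]
  have hiff := mem_nonCuspidalEtaQuotients_iff p hp3 hm hk
  refine ⟨⟨?_, ?_⟩, ?_⟩
  · rintro ⟨f, hf⟩
    obtain ⟨n, -, hn, -⟩ := (hiff f).mp hf
    exact ⟨n, hn⟩
  · rintro ⟨n, rfl⟩
    exact ⟨_, (hiff _).mpr ⟨n, nonneg_of_mul_nonneg_right hk hm0, rfl, .inl rfl⟩⟩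
  · rintro hk0 ⟨n, rfl⟩
    have hn : 0 < n := pos_of_mul_pos_right hk0 hm0.le
    have d1 : 2 * (p : ℤ) * (m * n) / (p - 1) = p * n := by
      rw [hmR, show 2 * (p : ℤ) * (m * n) = 2 * m * (p * n) by ring]
      exact Int.mul_ediv_cancel_left _ (by omega)
    have d2 : 2 * ((m : ℤ) * n) / (p - 1) = n := by
      rw [hmR, ← mul_assoc]
      exact Int.mul_ediv_cancel_left _ (by omega)
    have hOne : etaQuotientOne p (m * n) = etaPair p (-n) (p * n) := by
      funext z
      rw [etaQuotientOne, d1, d2, etaPair, zpow_neg, div_eq_mul_inv, mul_comm]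
    have hTwo : etaQuotientTwo p (m * n) = etaPair p (p * n) (-n) := by
      funext z
      rw [etaQuotientTwo, d1, d2, etaPair, zpow_neg, div_eq_mul_inv]
    rw [hOne, hTwo]
    refine ⟨Set.ext fun f ↦ ?_, etaPair_ne_etaPair p m hm hn⟩
    rw [hiff, Set.mem_insert_iff, Set.mem_singleton_iff]
    constructor
    · rintro ⟨n', -, h, hf⟩
      obtain rfl : n = n' := mul_left_cancel₀ hm0.ne' h
      exact hf.symm
    · exact fun hf ↦ ⟨n, hn.le, rfl, hf.symm⟩
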